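/- Let $X$ be a connected (Hausdorff) CW complex that is an $H$-space, with fundamental group $\pi=\pi_1(X)$, and let $m\ge 2$ be an integer. Then $$\mathrm{dTC}^{D}_m(X)=\mathrm{dcat}_1(X^{m-1}),$$ where the invariants are defined as follows. For a Hausdorff space $E$, a map $p\colon E\to B$ and an integer $n\ge 1$, let $E_n$ be the space of all probability measures $\mu=\sum_{i=1}^n a_i\delta_{z_i}$ on $E$ (with $a_i\ge 0$ and $\sum_i a_i=1$) whose support $\{z_i\mid a_i>0\}$ is contained in a single fibre $p^{-1}(b)$, with the topology of weak convergence of Borel probability measures (when $E$ is metrizable this is the topology of the Lévy–Prokhorov metric). Let $p_n\colon E_n\to B$ be the map that sends a measure supported in $p^{-1}(b)$ to $b$. The distributional sectional category $\mathrm{dsecat}(p)\in\{0,1,2,\dots\}\cup\{\infty\}$ is the least integer $k\ge 0$ for which $p_{k+1}$ has a continuous section, and $\infty$ if there is no such $k$. For a space $Y$ with universal covering $q^Y\colon\widetilde Y\to Y$, the distributional one-category is $\mathrm{dcat}_1(Y)=\mathrm{dsecat}(q^Y)$. The $m$-th sequential diagonal distributional complexity is $\mathrm{dTC}^{D}_m(X)=\mathrm{dsecat}(r^X_m)$,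 where $r^X_m\colon \widetilde X^m/\pi\to X^m$ is the covering map induced by the $m$-fold product of $q^X$ on the orbit space of the diagonal action of $\pi$ on $\widetilde X^m$. Powers of spaces carry the product topology. -/

import Mathlib

open MeasureTheory Topology
open scoped unitInterval ENNReal

/-! ### The universal covering space and the diagonal covering space -/

/-- The space `P₀(X)` of paths in `X` that end at the base point `x₀`, with the compact-open
topology. -/
def BasedPath {X : Type*} [TopologicalSpace X] (x₀ : X) : Type _ :=
  {γ : C(I, X) // γ 1 = x₀}

instance {X : Type*} [TopologicalSpace X] (x₀ : X) : TopologicalSpace (BasedPath x₀) :=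
  inferInstanceAs (TopologicalSpace {γ : C(I, X) // γ 1 = x₀})

/-- The universal covering space of `X`: the set of homotopy classes, relative to the end points, of
paths in `X` that end at `x₀`. -/
def UniversalCover {X : Type*} [TopologicalSpace X] (x₀ : X) : Type _ :=
  Σ x : X, Path.Homotopic.Quotient x x₀

namespace UniversalCover

variable {X : Type*} [TopologicalSpace X] {x₀ : X}

/-- The map that sends a path ending at `x₀` to its homotopy class. -/
def ofPath (γ : BasedPath x₀) : UniversalCover x₀ :=
  ⟨γ.1 0, Path.Homotopic.Quotient.mk ⟨γ.1, rfl, γ.2⟩⟩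

/-- The quotient topology with respect to `BasedPath x₀ → UniversalCover x₀`. -/
instance : TopologicalSpace (UniversalCover x₀) :=
  TopologicalSpace.coinduced ofPath inferInstance

/-- Measures on the universal covering space are Borel measures. -/
instance : MeasurableSpace (UniversalCover x₀) := borel _

instance : BorelSpace (UniversalCover x₀) := ⟨rfl⟩

/-- The universal covering map, which sends the class of a path to its starting point. -/
def proj (z : UniversalCover x₀) : X := z.1

theorem continuous_proj : Continuous (proj : UniversalCover x₀ → X) :=
  continuous_coinduced_dom.2 <|
    (ContinuousEvalConst.continuous_eval_const (F := C(I, X)) 0).comp continuous_subtype_val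

/-- The action of the fundamental group on the universal covering space by concatenation of paths.
In Mathlib the product `g * h` in the fundamental group is `h` followed by `g`, so this is a left
action. -/
noncomputable instance : MulAction (FundamentalGroup X x₀) (UniversalCover x₀) where
  smul g z := ⟨z.1, z.2.trans g.toPath⟩
  one_smul z := Sigma.ext rfl (heq_of_eq (Path.Homotopic.Quotient.trans_refl z.2))
  mul_smul g h z :=
    Sigma.ext rfl (heq_of_eq (Path.Homotopic.Quotient.trans_assoc z.2 h.toPath g.toPath).symm)

theorem proj_smul (g : FundamentalGroup X x₀) (z : UniversalCover x₀) :
    proj (g • z) = proj z := rfl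

end UniversalCover

/-- The orbit space of the diagonal action of `π₁(X, x₀)` on the `m`-fold power of the universal
covering space, with the quotient of the product topology. -/
def DiagonalCover {X : Type*} [TopologicalSpace X] (m : ℕ) (x₀ : X) : Type _ :=
  MulAction.orbitRel.Quotient (FundamentalGroup X x₀) (Fin m → UniversalCover x₀)

namespace DiagonalCover

variable {X : Type*} [TopologicalSpace X] {m : ℕ} {x₀ : X}

instance : TopologicalSpace (DiagonalCover m x₀) :=
  inferInstanceAs (TopologicalSpace
    (Quotient (MulAction.orbitRel (FundamentalGroup X x₀) (Fin m → UniversalCover x₀))))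

/-- Measures on the diagonal covering space are Borel measures. -/
instance : MeasurableSpace (DiagonalCover m x₀) := borel _

instance : BorelSpace (DiagonalCover m x₀) := ⟨rfl⟩

/-- The diagonal covering map, which sends the orbit of `(z₁, …, zₘ)` to the `m`-tuple of the
projections of the `zᵢ` to `X`. -/
noncomputable def proj : DiagonalCover m x₀ → (Fin m → X) :=
  Quotient.lift (fun z i => UniversalCover.proj (z i)) <| by
    rintro z w ⟨g, rfl⟩
    rfl

theorem continuous_proj : Continuous (proj : DiagonalCover m x₀ → (Fin m → X)) :=
  Continuous.quotient_lift
    (continuous_pi fun i => UniversalCover.continuous_proj.comp (continuous_apply i)) _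

end DiagonalCover

/-! ### Distributional sectional category -/

section DistributionalSectionalCategory

variable {E B : Type*} [MeasurableSpace E]

/-- The set of probability measures `a₁ δ_{z₁} + ⋯ + aₙ δ_{zₙ}` on `E` whose support
`{zᵢ | aᵢ ≠ 0}` is contained in `S`. -/
def finitelySupportedMeasures (n : ℕ) (S : Set E) : Set (ProbabilityMeasure E) :=
  {μ | ∃ (z : Fin n → E) (a : Fin n → ℝ≥0∞), ∑ i, a i = 1 ∧
    (μ : Measure E) = ∑ i, a i • Measure.dirac (z i) ∧ ∀ i, a i ≠ 0 → z i ∈ S}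

theorem finitelySupportedMeasures.measure_eq_one {n : ℕ} {S : Set E} (hS : MeasurableSet S)
    {μ : ProbabilityMeasure E} (h : μ ∈ finitelySupportedMeasures n S) :
    (μ : Measure E) S = 1 := by
  obtain ⟨z, a, ha, hμ, hz⟩ := h
  rw [hμ, Measure.finsetSum_apply, ← ha]
  refine Finset.sum_congr rfl fun i _ => ?_
  rw [Measure.smul_apply, Measure.dirac_apply' _ hS, smul_eq_mul]
  by_cases h0 : a i = 0
  · simp [h0]
  · simp [hz i h0]

variable [TopologicalSpace E] [BorelSpace E]

/-- The space of probability measures on `E` with at most `n` points in their support and with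
support contained in a single fibre of `p`. It is a subspace of the space of all Borel probability
measures, which has the topology of weak convergence (convergence in distribution). -/
def FibrewiseMeasures (p : E → B) (n : ℕ) : Type _ :=
  {μ : ProbabilityMeasure E // ∃ b : B, μ ∈ finitelySupportedMeasures n (p ⁻¹' {b})}

instance (p : E → B) (n : ℕ) : TopologicalSpace (FibrewiseMeasures p n) :=
  inferInstanceAs (TopologicalSpace
    {μ : ProbabilityMeasure E // ∃ b : B, μ ∈ finitelySupportedMeasures n (p ⁻¹' {b})})

/-- The map that sends a measure supported in the fibre of `p` over `b` to `b`. -/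
noncomputable def fibrewiseProj (p : E → B) (n : ℕ) (μ : FibrewiseMeasures p n) : B :=
  μ.2.choose

theorem fibrewiseProj_eq_iff [TopologicalSpace B] [T1Space B] {p : E → B} (hp : Continuous p)
    {n : ℕ} (μ : FibrewiseMeasures p n) (b : B) :
    fibrewiseProj p n μ = b ↔ μ.1 ∈ finitelySupportedMeasures n (p ⁻¹' {b}) := by
  have hm : ∀ c : B, MeasurableSet (p ⁻¹' {c}) := fun c =>
    (isClosed_singleton.preimage hp).measurableSet
  refine ⟨fun h => h ▸ μ.2.choose_spec, fun h => ?_⟩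
  have h1 := finitelySupportedMeasures.measure_eq_one (hm b) h
  have h2 := finitelySupportedMeasures.measure_eq_one (hm (fibrewiseProj p n μ)) μ.2.choose_spec
  by_contra hne
  have hd : Disjoint (p ⁻¹' {fibrewiseProj p n μ}) (p ⁻¹' {b}) :=
    Disjoint.preimage p (by simpa using hne)
  have h3 := measure_union (μ := (μ.1 : Measure E)) hd (hm b)
  rw [h1, h2] at h3
  have h4 : (1 : ℝ≥0∞) + 1 ≤ 1 := h3 ▸ prob_le_one
  norm_num at h4

/-- The distributional sectional category of `p`: the least `k` such that the map
`FibrewiseMeasures p (k + 1) → B` has a (continuous) section, and `⊤` if there is no such `k`. -/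
noncomputable def dsecat [TopologicalSpace B] (p : E → B) : ℕ∞ :=
  ⨅ (k : ℕ) (_ : ∃ s : C(B, FibrewiseMeasures p (k + 1)),
    ∀ b : B, fibrewiseProj p (k + 1) (s b) = b), (k : ℕ∞)

end DistributionalSectionalCategory

/-- The distributional one-category of `X`. -/
noncomputable def dcatOne (X : Type*) [TopologicalSpace X] (x₀ : X) : ℕ∞ :=
  dsecat (UniversalCover.proj : UniversalCover x₀ → X)

/-- The `m`-th sequential diagonal distributional complexity of `X`. -/
noncomputable def dTCDiag (m : ℕ) (X : Type*) [TopologicalSpace X] (x₀ : X) : ℕ∞ :=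
  dsecat (DiagonalCover.proj : DiagonalCover m x₀ → (Fin m → X))

/-! ### Sections over CW complexes -/

section CellularSections

variable {X : Type*} [TopologicalSpace X] [T2Space X] [CWComplex (Set.univ : Set X)]

open Metric RelCWComplex

/-! Sections by finitely supported measures pull back along pullbacks of coverings
(`dsecat_le_of_pullback`), so it suffices that each of the two coverings is a pullback of the other.
Write m = k + 1.

Along y ↦ (x₀, y) the diagonal covering of Xᵏ⁺¹ restricts to the universal covering of Xᵏ: every
orbit over (x₀, y) has exactly one representative whose first coordinate is the class of the
constant path. This needs no multiplication (`dcatOne_le_dTCDiag`).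

For the other direction, `HSpace.exists_right_inverse` gives a map inv with x · inv(x) homotopic to
e; put d(x, y) = x · inv(y). Then (z₀, …, z_k) ↦ (d(z₁, z₀), …, d(z_k, z₀)) pulls the universal
covering of Xᵏ back to the diagonal covering (`dTCDiag_le_dcatOne`). Since d is null-homotopic on
the diagonal, its lift is invariant under the diagonal action; since d(·, b) is homotopic to the
identity, the lift is bijective on fibres. Associativity plays no role.

The inverse is built cell by cell. A point y with a path from x · y to e is a point of the homotopy
fibre of left multiplication by x. That map is homotopic to the identity because X is
path-connected, so these fibres are contractible and solutions extend from spheres to balls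
(`exists_extend_paths_to_unit`).

In the pullback lemma the measures are lifted atom by atom, and the issue is weak continuity of the
result (`tendsto_sum_lift`). It needs many bounded continuous functions on the total space, hence
the proof that CW complexes are completely regular and that separated local homeomorphisms inherit
this. The universal covering carries a quotient of the compact-open topology, which is identified
with the topology generated by sheets over contracting neighbourhoods. -/

theorem CWComplex.continuousOn_skeletonLT {Z : Type*} [TopologicalSpace Z] {f : X → Z} {n : ℕ∞}
    (h : ∀ m : ℕ, (m : ℕ∞) < n → ∀ i : cell (Set.univ : Set X) m,
      ContinuousOn (f ∘ map m i) (closedBall 0 1)) :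
    ContinuousOn f (skeletonLT (Set.univ : Set X) n : Set X) := by
  have hS : IsClosed (skeletonLT (Set.univ : Set X) n : Set X) := Subcomplex.closed _
  rw [continuousOn_iff_isClosed]
  intro K hK
  refine ⟨f ⁻¹' K ∩ skeletonLT (Set.univ : Set X) n, ?_, by simp [Set.inter_assoc]⟩
  refine CWComplex.isClosed_of_disjoint_openCell_or_isClosed_inter_closedCell
    (C := Set.univ) (Set.subset_univ _) fun m _ i => ?_
  rcases lt_or_ge (m : ℕ∞) n with hm | hm
  · right
    have hsub : closedCell m i ⊆ (skeletonLT (Set.univ : Set X) n : Set X) :=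
      (closedCell_subset_skeletonLT m i).trans
        (skeletonLT_mono (by exact_mod_cast Order.add_one_le_of_lt hm))
    have heq : f ⁻¹' K ∩ skeletonLT (Set.univ : Set X) n ∩ closedCell m i =
        map m i '' (closedBall 0 1 ∩ (f ∘ map m i) ⁻¹' K) := by
      rw [Set.inter_assoc, Set.inter_eq_right.2 hsub, closedCell, Set.inter_comm,
        Set.image_inter_preimage (map m i) (closedBall 0 1) (f ⁻¹' K) |>.symm]
      rfl
    rw [heq]
    refine IsCompact.isClosed (IsCompact.image_of_continuousOn ?_
      ((continuousOn m i).mono Set.inter_subset_left))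
    exact (isCompact_closedBall _ _).of_isClosed_subset
      ((h m hm i).preimage_isClosed_of_isClosed isClosed_closedBall hK) Set.inter_subset_left
  · left
    exact (disjoint_skeletonLT_openCell hm).mono_left Set.inter_subset_right

/-- Distinct open cells are disjoint and miss the lower skeleton, so the extensions over the
individual cells can be chosen independently. -/
theorem CWComplex.exists_extend_skeletonLT_succ {Z : Type*} [TopologicalSpace Z]
    (Q : X → Z → Prop) (n : ℕ)
    (hQ : ∀ (i : cell (Set.univ : Set X) n) (g : (Fin n → ℝ) → Z),
      ContinuousOn g (sphere 0 1) → (∀ v ∈ sphere (0 : Fin n → ℝ) 1, Q (map n i v) (g v)) →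
      ∃ G : (Fin n → ℝ) → Z, ContinuousOn G (closedBall 0 1) ∧
        (∀ v ∈ closedBall (0 : Fin n → ℝ) 1, Q (map n i v) (G v)) ∧ Set.EqOn G g (sphere 0 1))
    {f : X → Z}
    (hf : ∀ m : ℕ, m < n → ∀ i : cell (Set.univ : Set X) m,
      ContinuousOn (f ∘ map m i) (closedBall 0 1))
    (hfQ : ∀ x ∈ skeletonLT (Set.univ : Set X) n, Q x (f x)) :
    ∃ f' : X → Z, (∀ m : ℕ, m < n + 1 → ∀ i : cell (Set.univ : Set X) m,
        ContinuousOn (f' ∘ map m i) (closedBall 0 1)) ∧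
      (∀ x ∈ skeletonLT (Set.univ : Set X) (n + 1 : ℕ), Q x (f' x)) ∧
      Set.EqOn f' f (skeletonLT (Set.univ : Set X) n : Set X) := by
  classical
  have hfc := CWComplex.continuousOn_skeletonLT (f := f) (n := n)
    fun m hm => hf m (by exact_mod_cast hm)
  have hmaps : ∀ i : cell (Set.univ : Set X) n, ∀ v ∈ sphere (0 : Fin n → ℝ) 1,
      map n i v ∈ (skeletonLT (Set.univ : Set X) n : Set X) := fun i v hv =>
    cellFrontier_subset_skeletonLT n i (Set.mem_image_of_mem _ hv)
  choose G hGc hGQ hGe using fun i => hQ i (f ∘ map n i)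
    (hfc.comp ((continuousOn n i).mono sphere_subset_closedBall) (hmaps i))
    (fun v hv => hfQ _ (hmaps i v hv))
  let f' : X → Z := fun x =>
    if h : ∃ i : cell (Set.univ : Set X) n, x ∈ openCell n i then
      G h.choose ((map n h.choose).symm x) else f x
  have hold : ∀ x ∈ (skeletonLT (Set.univ : Set X) n : Set X), f' x = f x := by
    intro x hx
    refine dif_neg ?_
    rintro ⟨i, hi⟩
    exact Set.disjoint_left.1 (disjoint_skeletonLT_openCell (j := i) le_rfl) hx hi
  have hnew : ∀ i : cell (Set.univ : Set X) n, ∀ v ∈ closedBall (0 : Fin n → ℝ) 1,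
      f' (map n i v) = G i v := by
    intro i v hv
    rw [← sphere_union_ball] at hv
    rcases hv with hv | hv
    · rw [hold _ (hmaps i v hv), hGe i hv]
      rfl
    · have h : ∃ j : cell (Set.univ : Set X) n, map n i v ∈ openCell n j :=
        ⟨i, Set.mem_image_of_mem _ hv⟩
      have hi : h.choose = i := by
        by_contra hne
        exact Set.disjoint_left.1 (disjoint_openCell_of_ne (C := Set.univ) (i := h.choose) (j := i)
          (by simpa using hne)) h.choose_spec (Set.mem_image_of_mem _ hv)
      simp only [f']
      rw [dif_pos h, hi, (map n i).left_inv (by rwa [source_eq])]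
  refine ⟨f', fun m hm i => ?_, fun x hx => ?_, hold⟩
  · rcases Nat.lt_succ_iff_lt_or_eq.1 hm with hm | rfl
    · refine (hf m hm i).congr fun v hv => hold _ ?_
      exact skeletonLT_mono (by exact_mod_cast hm)
        (closedCell_subset_skeletonLT m i (Set.mem_image_of_mem _ hv))
    · exact (hGc i).congr fun v hv => hnew i v hv
  · have hx' : x ∈ (skeletonLT (Set.univ : Set X) ((n : ℕ∞) + 1) : Set X) := by exact_mod_cast hx
    rw [← skeletonLT_union_iUnion_closedCell_eq_skeletonLT_succ] at hx'
    rcases hx' with hx' | hx'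
    · rw [hold x hx']
      exact hfQ x hx'
    · obtain ⟨i, v, hv, rfl⟩ := Set.mem_iUnion.1 hx'
      rw [hnew i v hv]
      exact hGQ i v hv

/-- Continuous sections of a relation over a CW complex exist if they extend over each cell. -/
theorem CWComplex.exists_continuous_section {Z : Type*} [TopologicalSpace Z] [Nonempty Z]
    (Q : X → Z → Prop)
    (hQ : ∀ (n : ℕ) (i : cell (Set.univ : Set X) n) (g : (Fin n → ℝ) → Z),
      ContinuousOn g (sphere 0 1) → (∀ v ∈ sphere (0 : Fin n → ℝ) 1, Q (map n i v) (g v)) →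
      ∃ G : (Fin n → ℝ) → Z, ContinuousOn G (closedBall 0 1) ∧
        (∀ v ∈ closedBall (0 : Fin n → ℝ) 1, Q (map n i v) (G v)) ∧ Set.EqOn G g (sphere 0 1)) :
    ∃ f : C(X, Z), ∀ x, Q x (f x) := by
  classical
  let P : ℕ → (X → Z) → Prop := fun n f =>
    (∀ m : ℕ, m < n → ∀ i : cell (Set.univ : Set X) m,
      ContinuousOn (f ∘ map m i) (closedBall 0 1)) ∧
    ∀ x ∈ skeletonLT (Set.univ : Set X) n, Q x (f x)
  have h0 : P 0 fun _ => Classical.arbitrary Z := by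
    refine ⟨fun m hm => absurd hm (Nat.not_lt_zero m), fun x hx => ?_⟩
    have : x ∈ (skeletonLT (Set.univ : Set X) 0 : Set X) := by exact_mod_cast hx
    rw [CWComplex.skeletonLT_zero_eq_empty] at this
    exact absurd this (Set.notMem_empty x)
  have hs : ∀ n (f : {f : X → Z // P n f}), ∃ f' : {f : X → Z // P (n + 1) f},
      Set.EqOn f'.1 f.1 (skeletonLT (Set.univ : Set X) n : Set X) := by
    rintro n ⟨f, hf⟩
    obtain ⟨f', h1, h2, h3⟩ := CWComplex.exists_extend_skeletonLT_succ Q n (hQ n) hf.1 hf.2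
    exact ⟨⟨f', h1, h2⟩, h3⟩
  choose S hS using hs
  let F : (n : ℕ) → {f : X → Z // P n f} := fun n => Nat.rec ⟨_, h0⟩ S n
  have hF : ∀ n, Set.EqOn (F (n + 1)).1 (F n).1 (skeletonLT (Set.univ : Set X) n : Set X) :=
    fun n => hS n (F n)
  have hF' : ∀ n k, Set.EqOn (F (n + k)).1 (F n).1 (skeletonLT (Set.univ : Set X) n : Set X) := by
    intro n k
    induction k with
    | zero => exact fun x _ => rfl
    | succ k ih =>
      intro x hx
      rw [← ih hx]
      exact hF (n + k) (skeletonLT_mono (by exact_mod_cast Nat.le_add_right n k) hx)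
  have hex : ∀ x : X, ∃ n : ℕ, x ∈ (skeletonLT (Set.univ : Set X) n : Set X) := by
    intro x
    have : x ∈ ⋃ n : ℕ, (skeletonLT (Set.univ : Set X) n : Set X) := by
      rw [iUnion_skeletonLT_eq_complex]
      trivial
    exact Set.mem_iUnion.1 this
  -- Each point takes its value at the first stage whose skeleton contains it; by `hF'` later stages
  -- do not change it.
  let f : X → Z := fun x => (F (Nat.find (hex x))).1 x
  have hf : ∀ n, Set.EqOn f (F n).1 (skeletonLT (Set.univ : Set X) n : Set X) := by
    intro n x hx
    obtain ⟨k, rfl⟩ := Nat.exists_eq_add_of_le (Nat.find_min' (hex x) hx)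
    exact (hF' _ k (Nat.find_spec (hex x))).symm
  have hfc : Continuous f := by
    rw [← continuousOn_univ]
    have := CWComplex.continuousOn_skeletonLT (X := X) (f := f) (n := ⊤) fun m _ i => by
      refine ((F (m + 1)).2.1 m m.lt_succ_self i).congr fun v hv => hf (m + 1) ?_
      exact_mod_cast closedCell_subset_skeletonLT m i (Set.mem_image_of_mem _ hv)
    rwa [skeletonLT_top] at this
  refine ⟨⟨f, hfc⟩, fun x => ?_⟩
  obtain ⟨n, hn⟩ := hex x
  rw [ContinuousMap.coe_mk, hf n hn]
  exact (F n).2.2 x hn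

end CellularSections

/-! ### Collar extension of paths, and spaces with contracting neighbourhoods -/

/-- A family of paths that starts at `φ` and is given on the unit sphere extends to the unit ball
in such a way that near the sphere the end points of the paths do not change along radii. -/
theorem exists_extend_paths_collar {X : Type*} [TopologicalSpace X] {E : Type*} [NormedAddCommGroup E] [NormedSpace ℝ E]
    (φ : C(E, X)) {g : E → C(I, X)} (hg : ContinuousOn g (Metric.sphere 0 1))
    (h0 : ∀ v ∈ Metric.sphere (0 : E) 1, g v 0 = φ v) :
    ∃ G : C(E, C(I, X)), (∀ v, ‖v‖ ≤ 1 → G v 0 = φ v) ∧ Set.EqOn G g (Metric.sphere 0 1) ∧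
      ∀ v, 1 / 2 ≤ ‖v‖ → ‖v‖ ≤ 1 → G v 1 = g (‖v‖⁻¹ • v) 1 := by
  -- `B` is `φ` on the unit ball, and at radius `1 + t` it is the path `g` at time `t`.
  let B : E → X := fun w => if ‖w‖ ≤ 1 then φ w else
    g (‖w‖⁻¹ • w) (Set.projIcc 0 1 zero_le_one (‖w‖ - 1))
  have hsph : ∀ w : E, 0 < ‖w‖ → ‖w‖⁻¹ • w ∈ Metric.sphere (0 : E) 1 := by
    intro w hw
    rw [_root_.mem_sphere_zero_iff_norm, norm_smul, norm_inv, norm_norm, inv_mul_cancel₀ hw.ne']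
  have hB : Continuous B := by
    refine continuous_if_le continuous_norm continuous_const φ.continuous.continuousOn ?_ ?_
    · refine ContinuousOn.eval ?_ (Continuous.continuousOn (by fun_prop))
      refine hg.comp ?_ ?_
      · refine ContinuousOn.smul (ContinuousOn.inv₀ continuousOn_id.norm ?_) continuousOn_id
        intro w hw
        have : (1 : ℝ) ≤ ‖w‖ := hw
        positivity
      · intro w hw
        exact hsph w (lt_of_lt_of_le one_pos hw)
    · intro w hw
      have hw' : w ∈ Metric.sphere (0 : E) 1 := _root_.mem_sphere_zero_iff_norm.2 hw
      rw [hw, sub_self, Set.projIcc_left, inv_one, one_smul]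
      exact (h0 w hw').symm
  -- The path at `v` is `B` along the ray from `v`. The factor is chosen so that for `‖v‖ ≥ 1 / 2`
  -- it stops exactly at radius 2, where `g` has reached its end point; the `max` only avoids
  -- division by zero at the origin.
  let lam : E × I → ℝ := fun p => 1 + p.2 * (2 - ‖p.1‖) / max ‖p.1‖ (1 / 2)
  have hlam : Continuous lam := by
    refine continuous_const.add (Continuous.div (by fun_prop) (by fun_prop) fun p => ?_)
    positivity
  have hF : Continuous fun p : E × I => B (lam p • p.1) := hB.comp (hlam.smul continuous_fst)
  refine ⟨ContinuousMap.curry ⟨_, hF⟩, fun v hv => ?_, fun v hv => ?_, fun v hv hv1 => ?_⟩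
  · simp [B, lam, hv]
  · ext t
    have hv' := _root_.mem_sphere_zero_iff_norm.1 hv
    have hl : lam (v, t) = 1 + t := by
      simp only [lam, hv']
      norm_num
    simp only [ContinuousMap.curry_apply, ContinuousMap.coe_mk, hl, B, norm_smul, hv', mul_one]
    have ht : ‖(1 : ℝ) + t‖ = 1 + t := Real.norm_of_nonneg (by linarith [t.2.1])
    rw [ht]
    split_ifs with h
    · have : t = 0 := Subtype.ext (le_antisymm (by simpa using h) t.2.1)
      subst this
      simp [h0 v hv]
    · rw [smul_smul, inv_mul_cancel₀ (by linarith [t.2.1]), one_smul, add_sub_cancel_left,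
        Set.projIcc_val]
  · have hr : 0 < ‖v‖ := by linarith
    have hl : lam (v, 1) = 2 * ‖v‖⁻¹ := by
      simp only [lam, max_eq_left hv, Set.Icc.coe_one]
      field_simp
      ring
    have hn : ‖(2 * ‖v‖⁻¹) • v‖ = 2 := by
      rw [norm_smul, norm_mul, norm_inv, norm_norm]
      field_simp
      norm_num
    simp only [ContinuousMap.curry_apply, ContinuousMap.coe_mk, hl, B, hn]
    rw [if_neg (by norm_num), smul_smul]
    norm_num
    congr 2
    rw [← mul_assoc]
    norm_num

/-- Every point has a neighbourhood that can be contracted to the point by a homotopy of the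
identity of the whole space. -/
def LocallyContractsInside (Y : Type*) [TopologicalSpace Y] : Prop :=
  ∀ y : Y, ∃ V ∈ 𝓝 y, ∃ H : C(Y, C(I, Y)), (∀ z, H z 0 = z) ∧ ∀ z ∈ V, H z 1 = y

/-! ### Complete regularity and local path-connectedness of CW complexes -/

section CellularApplications

variable {X : Type*} [TopologicalSpace X] [T2Space X] [CWComplex (Set.univ : Set X)]

open Metric RelCWComplex

/-- A variant of `CWComplex.exists_continuous_section` in which the characteristic maps are replaced
by continuous maps that are defined everywhere. -/
theorem CWComplex.exists_continuous_section' {Z : Type*} [TopologicalSpace Z] [Nonempty Z]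
    (Q : X → Z → Prop)
    (hQ : ∀ (n : ℕ) (i : cell (Set.univ : Set X) n) (φ : C(Fin n → ℝ, X)),
      Set.EqOn φ (map n i) (closedBall 0 1) → ∀ g : (Fin n → ℝ) → Z,
      ContinuousOn g (sphere 0 1) → (∀ v ∈ sphere (0 : Fin n → ℝ) 1, Q (φ v) (g v)) →
      ∃ G : C(closedBall (0 : Fin n → ℝ) 1, Z), (∀ v : closedBall (0 : Fin n → ℝ) 1, Q (φ v) (G v)) ∧
        ∀ v : closedBall (0 : Fin n → ℝ) 1, ‖v.1‖ = 1 → G v = g v) :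
    ∃ f : C(X, Z), ∀ x, Q x (f x) := by
  refine CWComplex.exists_continuous_section Q fun n i g hg hgQ => ?_
  -- The radial retraction onto the unit ball.
  let ρ : (Fin n → ℝ) → (Fin n → ℝ) := fun v => (max 1 ‖v‖)⁻¹ • v
  have hρ : Continuous ρ := by
    have h : Continuous fun v : Fin n → ℝ => max 1 ‖v‖ := by fun_prop
    exact (h.inv₀ fun v => by positivity).smul continuous_id
  have hρm : ∀ v, ρ v ∈ closedBall (0 : Fin n → ℝ) 1 := by
    intro v
    rw [mem_closedBall_zero_iff, norm_smul, norm_inv, Real.norm_of_nonneg (by positivity),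
      inv_mul_le_one₀ (by positivity)]
    exact le_max_right _ _
  have hρe : ∀ v ∈ closedBall (0 : Fin n → ℝ) 1, ρ v = v := by
    intro v hv
    rw [mem_closedBall_zero_iff] at hv
    simp [ρ, max_eq_left hv]
  let φ : C(Fin n → ℝ, X) :=
    ⟨fun v => map n i (ρ v), (continuousOn n i).comp_continuous hρ hρm⟩
  have hφ : Set.EqOn φ (map n i) (closedBall 0 1) := fun v hv => congrArg (map n i) (hρe v hv)
  obtain ⟨G, hG, hGe⟩ := hQ n i φ hφ g hg fun v hv => by
    rw [hφ (sphere_subset_closedBall hv)]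
    exact hgQ v hv
  have hGv : ∀ v (hv : v ∈ closedBall (0 : Fin n → ℝ) 1), G ⟨ρ v, hρm v⟩ = G ⟨v, hv⟩ :=
    fun v hv => congrArg G (Subtype.ext (hρe v hv))
  refine ⟨fun v => G ⟨ρ v, hρm v⟩,
    (G.continuous.comp (hρ.subtype_mk hρm)).continuousOn, fun v hv => ?_, fun v hv => ?_⟩
  · beta_reduce
    rw [hGv v hv, ← hφ hv]
    exact hG ⟨v, hv⟩
  · beta_reduce
    rw [hGv v (sphere_subset_closedBall hv)]
    exact hGe _ (mem_sphere_zero_iff_norm.1 hv)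

/-- A separating function is a section of a relation. Over a cell its values are prescribed on the
closed union of the sphere and the preimages of `x` and `K`, and Tietze extends them to the ball. -/
theorem CWComplex.completelyRegularSpace : CompletelyRegularSpace X := by
  refine ⟨fun x K hK hx => ?_⟩
  suffices h : ∃ f : C(X, ℝ), ∀ y, f y ∈ Set.Icc (0 : ℝ) 1 ∧ (y = x → f y = 0) ∧
      (y ∈ K → f y = 1) by
    obtain ⟨f, hf⟩ := h
    exact ⟨fun y => ⟨f y, (hf y).1⟩, f.continuous.subtype_mk _, Subtype.ext ((hf x).2.1 rfl),
      fun y hy => Subtype.ext ((hf y).2.2 hy)⟩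
  refine CWComplex.exists_continuous_section'
    (fun y (z : ℝ) => z ∈ Set.Icc (0 : ℝ) 1 ∧ (y = x → z = 0) ∧ (y ∈ K → z = 1)) ?_
  intro n i φ _ g hg hgQ
  classical
  have hx1 : IsClosed (φ ⁻¹' {x}) := isClosed_singleton.preimage φ.continuous
  have hK1 : IsClosed (φ ⁻¹' K) := hK.preimage φ.continuous
  have hS1 : IsClosed (sphere (0 : Fin n → ℝ) 1) := isClosed_sphere
  let A : Set (Fin n → ℝ) := sphere 0 1 ∪ (φ ⁻¹' {x} ∪ φ ⁻¹' K)
  have hA : IsClosed A := hS1.union (hx1.union hK1)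
  let g' : (Fin n → ℝ) → ℝ := fun v => if φ v ∈ K then 1 else if φ v = x then 0 else g v
  have e1 : ∀ v, φ v ∈ K → g' v = 1 := fun v hv => if_pos hv
  have e2 : ∀ v, φ v = x → g' v = 0 := fun v hv => by
    simp only [g']
    rw [if_neg (by rwa [hv]), if_pos hv]
  have e3 : ∀ v ∈ sphere (0 : Fin n → ℝ) 1, g' v = g v := by
    intro v hv
    by_cases h1 : φ v ∈ K
    · rw [e1 v h1, (hgQ v hv).2.2 h1]
    by_cases h2 : φ v = x
    · rw [e2 v h2, (hgQ v hv).2.1 h2]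
    simp [g', h1, h2]
  have hg' : ContinuousOn g' A := by
    refine (hg.congr e3).union_of_isClosed (ContinuousOn.union_of_isClosed ?_ ?_ hx1 hK1) hS1
      (hx1.union hK1)
    · exact continuousOn_const.congr fun v hv => e2 v hv
    · exact continuousOn_const.congr fun v hv => e1 v hv
  have hm : ∀ v : A, g' v ∈ Set.Icc (0 : ℝ) 1 := by
    rintro ⟨v, hv | hv | hv⟩
    · rw [e3 v hv]
      exact (hgQ v hv).1
    · simp [e2 v hv]
    · simp [e1 v hv]
  obtain ⟨G, hG, hGe⟩ := ContinuousMap.exists_restrict_eq_forall_mem_of_closed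
    (⟨A.domRestrict g', hg'.domRestrict⟩ : C(A, ℝ)) hm ⟨0, by simp⟩ hA
  have hGe' : ∀ v ∈ A, G v = g' v := fun v hv => DFunLike.congr_fun hGe ⟨v, hv⟩
  refine ⟨G.comp ⟨Subtype.val, continuous_subtype_val⟩, fun v => ⟨hG v, fun h => ?_, fun h => ?_⟩,
    fun v hv => ?_⟩
  · exact (hGe' v (.inr (.inl h))).trans (e2 v h)
  · exact (hGe' v (.inr (.inr h))).trans (e1 v h)
  · have hv' : v.1 ∈ sphere (0 : Fin n → ℝ) 1 := mem_sphere_zero_iff_norm.2 hv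
    exact (hGe' v (.inl hv')).trans (e3 v hv')

/-- Openness of a path component of an open set is tested on closed cells. In the ball it holds
because small balls meet the unit ball in convex sets. -/
theorem CWComplex.locallyPathConnectedSpace : LocallyPathConnectedSpace X := by
  rw [locallyPathConnectedSpace_iff_isOpen_pathComponentIn]
  intro x U hU
  rw [← isClosed_compl_iff, CWComplex.closed Set.univ _ (Set.subset_univ _)]
  intro n i
  have : (pathComponentIn U x)ᶜ ∩ closedCell n i =
      map n i '' (closedBall 0 1 ∩ map n i ⁻¹' (pathComponentIn U x)ᶜ) := by
    rw [closedCell, Set.inter_comm, Set.image_inter_preimage]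
  rw [this]
  refine IsCompact.isClosed (IsCompact.image_of_continuousOn ?_
    ((continuousOn n i).mono Set.inter_subset_left))
  refine (isCompact_closedBall _ _).of_isClosed_subset ?_ Set.inter_subset_left
  rw [← isOpen_compl_iff, isOpen_iff_mem_nhds]
  intro v hv
  by_cases hvD : v ∈ closedBall (0 : Fin n → ℝ) 1
  swap
  · filter_upwards [isClosed_closedBall.isOpen_compl.mem_nhds hvD] with w hw hw'
    exact hw hw'.1
  have hvU : map n i v ∈ pathComponentIn U x := by
    by_contra h
    exact hv ⟨hvD, h⟩
  have hnh : map n i ⁻¹' U ∈ 𝓝[closedBall 0 1] v :=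
    (continuousOn n i v hvD) (hU.mem_nhds (pathComponentIn_subset hvU))
  obtain ⟨ε, hε, hεU⟩ := Metric.mem_nhdsWithin_iff.1 hnh
  filter_upwards [ball_mem_nhds v hε] with w hw hw'
  refine hw'.2 ?_
  have hpc : IsPathConnected (ball v ε ∩ closedBall (0 : Fin n → ℝ) 1) :=
    ((convex_ball v ε).inter (convex_closedBall 0 1)).isPathConnected
      ⟨v, mem_ball_self hε, hvD⟩
  have hj := (hpc.image' ((continuousOn n i).mono Set.inter_subset_right)).joinedIn
    (map n i v) ⟨v, ⟨mem_ball_self hε, hvD⟩, rfl⟩ (map n i w) ⟨w, ⟨hw, hw'.1⟩, rfl⟩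
  exact JoinedIn.trans hvU (hj.mono (Set.image_subset_iff.2 hεU))

end CellularApplications

/-! ### Contracting neighbourhoods in CW complexes -/

section CellularContractions

variable {X : Type*} [TopologicalSpace X] [T2Space X] [CWComplex (Set.univ : Set X)]

open Metric RelCWComplex

/-- The neighbourhood and its contraction are built together, as a real function positive at `x` and
a path from each point that ends at `x` wherever the function is positive. Below the dimension of
the cell of `x` this is trivial, in that cell it is a straight-line contraction, and in higher cells
it spreads along collars. -/
theorem CWComplex.locallyContractsInside : LocallyContractsInside X := by
  intro x
  obtain ⟨n₀, i₀, v₀, hv₀, hx⟩ : ∃ (n : ℕ) (i : cell (Set.univ : Set X) n),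
      ∃ v ∈ ball (0 : Fin n → ℝ) 1, map n i v = x := by
    have : x ∈ ⋃ (n : ℕ) (i : cell (Set.univ : Set X) n), openCell n i := by
      rw [CWComplex.iUnion_openCell_eq_complex]
      trivial
    simpa [openCell] using this
  have hxo : x ∈ openCell n₀ i₀ := ⟨v₀, hv₀, hx⟩
  have hxS : ∀ n : ℕ, n ≤ n₀ → x ∉ (skeletonLT (Set.univ : Set X) n : Set X) := fun n hn h =>
    Set.disjoint_left.1 (disjoint_skeletonLT_openCell (j := i₀) (by exact_mod_cast hn)) h hxo
  suffices h : ∃ f : C(X, ℝ × C(I, X)), ∀ y, (f y).2 0 = y ∧ (0 < (f y).1 → (f y).2 1 = x) ∧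
      (y = x → 0 < (f y).1) ∧ (y ∈ skeletonLT (Set.univ : Set X) n₀ →
        f y = (0, ContinuousMap.const I y)) by
    obtain ⟨f, hf⟩ := h
    refine ⟨{y | 0 < (f y).1}, ?_, ⟨fun y => (f y).2, by fun_prop⟩, fun y => (hf y).1,
      fun y hy => (hf y).2.1 hy⟩
    exact (isOpen_lt continuous_const (by fun_prop)).mem_nhds ((hf x).2.2.1 rfl)
  have : Nonempty (ℝ × C(I, X)) := ⟨0, ContinuousMap.const I x⟩
  refine CWComplex.exists_continuous_section' (fun y (z : ℝ × C(I, X)) => z.2 0 = y ∧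
    (0 < z.1 → z.2 1 = x) ∧ (y = x → 0 < z.1) ∧ (y ∈ skeletonLT (Set.univ : Set X) n₀ →
      z = (0, ContinuousMap.const I y))) fun n i φ hφ g hg hgQ => ?_
  have hsph : ∀ v ∈ sphere (0 : Fin n → ℝ) 1, φ v ∈ (skeletonLT (Set.univ : Set X) n : Set X) := by
    intro v hv
    rw [hφ (sphere_subset_closedBall hv)]
    exact cellFrontier_subset_skeletonLT n i (Set.mem_image_of_mem _ hv)
  have hball : ∀ v ∈ ball (0 : Fin n → ℝ) 1, φ v ∈ openCell n i := by
    intro v hv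
    rw [hφ (ball_subset_closedBall hv)]
    exact Set.mem_image_of_mem _ hv
  have hball' : n₀ ≤ n → ∀ v ∈ ball (0 : Fin n → ℝ) 1,
      φ v ∉ (skeletonLT (Set.univ : Set X) n₀ : Set X) := fun hn v hv h =>
    Set.disjoint_left.1 (disjoint_skeletonLT_openCell (j := i) (by exact_mod_cast hn)) h
      (hball v hv)
  have hcell : ∀ v ∈ ball (0 : Fin n → ℝ) 1, φ v = x →
      (⟨n, i⟩ : Σ n, cell (Set.univ : Set X) n) = ⟨n₀, i₀⟩ := by
    intro v hv h
    by_contra hne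
    exact Set.disjoint_left.1 (disjoint_openCell_of_ne hne) (hball v hv) (h ▸ hxo)
  have hdich : ∀ v : closedBall (0 : Fin n → ℝ) 1, v.1 ∈ sphere (0 : Fin n → ℝ) 1 ∨
      v.1 ∈ ball (0 : Fin n → ℝ) 1 := by
    intro v
    rw [← Set.mem_union, sphere_union_ball]
    exact v.2
  have hval : Continuous fun v : closedBall (0 : Fin n → ℝ) 1 => v.1 := continuous_subtype_val
  rcases lt_or_ge n₀ n with hn | hn
  · obtain ⟨G, hG0, hGe, hG1⟩ := exists_extend_paths_collar φ (g := fun v => (g v).2)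
      (continuous_snd.comp_continuousOn hg) fun v hv => (hgQ v hv).1
    -- The function is cut off at half the radius, so its positivity set stays in the collar, where
    -- end points of paths agree with those on the sphere.
    let h : (Fin n → ℝ) → ℝ := fun v => if ‖v‖ ≤ 1 / 2 then 0 else
      (2 * ‖v‖ - 1) * (g (‖v‖⁻¹ • v)).1
    have hh : Continuous h := by
      refine continuous_if_le continuous_norm continuous_const continuousOn_const ?_ ?_
      · refine ContinuousOn.mul (Continuous.continuousOn (by fun_prop))
          (continuous_fst.comp_continuousOn (hg.comp ?_ ?_))
        · refine ContinuousOn.smul (ContinuousOn.inv₀ continuousOn_id.norm ?_) continuousOn_id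
          intro w hw
          have : (1 / 2 : ℝ) ≤ ‖w‖ := hw
          have : 0 < ‖w‖ := by linarith
          exact this.ne'
        · intro w hw
          have : (1 / 2 : ℝ) ≤ ‖w‖ := hw
          have : 0 < ‖w‖ := by linarith
          rw [mem_sphere_zero_iff_norm, norm_smul, norm_inv, norm_norm, inv_mul_cancel₀ this.ne']
      · intro w hw
        rw [hw]
        norm_num
    have he : ∀ v ∈ sphere (0 : Fin n → ℝ) 1, (h v, G v) = g v := by
      intro v hv
      refine Prod.ext ?_ (hGe hv)
      have hv' := mem_sphere_zero_iff_norm.1 hv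
      simp only [h, hv']
      norm_num
    refine ⟨⟨fun v => (h v, G v), (hh.prodMk G.continuous).comp hval⟩, fun v => ?_,
      fun v hv => he v (mem_sphere_zero_iff_norm.2 hv)⟩
    rcases hdich v with hv | hv
    · have := hgQ v hv
      rwa [← he v hv] at this
    · have hv1 : ‖v.1‖ ≤ 1 := (mem_ball_zero_iff.1 hv).le
      refine ⟨hG0 v hv1, fun hpos => ?_, fun h => ?_, fun h => absurd h (hball' hn.le v hv)⟩
      · have hv2 : 1 / 2 < ‖v.1‖ := by
          by_contra hlt
          simp only [ContinuousMap.coe_mk, h, if_pos (not_lt.1 hlt), lt_irrefl] at hpos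
        have hpos' : 0 < (g (‖v.1‖⁻¹ • v.1)).1 := by
          simp only [ContinuousMap.coe_mk, h, if_neg (not_le.2 hv2)] at hpos
          exact pos_of_mul_pos_right hpos (by linarith)
        have hs : ‖v.1‖⁻¹ • v.1 ∈ sphere (0 : Fin n → ℝ) 1 := by
          have : 0 < ‖v.1‖ := by linarith
          rw [mem_sphere_zero_iff_norm, norm_smul, norm_inv, norm_norm, inv_mul_cancel₀ this.ne']
        exact (hG1 v hv2.le hv1).trans ((hgQ _ hs).2.1 hpos')
      · have := hcell v hv h
        simp only [Sigma.mk.injEq] at this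
        omega
  · have hsk : ∀ v ∈ sphere (0 : Fin n → ℝ) 1,
        φ v ∈ (skeletonLT (Set.univ : Set X) n₀ : Set X) := fun v hv =>
      skeletonLT_mono (by exact_mod_cast hn) (hsph v hv)
    have hgs : ∀ v ∈ sphere (0 : Fin n → ℝ) 1, g v = (0, ContinuousMap.const I (φ v)) :=
      fun v hv => (hgQ v hv).2.2.2 (hsk v hv)
    by_cases hc : (⟨n, i⟩ : Σ n, cell (Set.univ : Set X) n) = ⟨n₀, i₀⟩
    · cases hc
      have hpos : 0 < 1 - ‖v₀‖ := by
        have := mem_ball_zero_iff.1 hv₀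
        linarith
      -- The common expression is 2 at `v₀` and 0 on the sphere. Hence `h v₀ = 1`, and `τ = 1`, a
      -- full contraction to `v₀`, wherever `h` is positive.
      let h : (Fin n₀ → ℝ) → ℝ := fun v => max 0 (2 / (1 - ‖v₀‖) * (1 - ‖v‖) - 1)
      let τ : (Fin n₀ → ℝ) → ℝ := fun v => min 1 (2 / (1 - ‖v₀‖) * (1 - ‖v‖))
      have hh : Continuous h := by fun_prop
      have hτ : Continuous τ := by fun_prop
      have hF : Continuous fun p : (Fin n₀ → ℝ) × I => φ (p.1 + (p.2 * τ p.1) • (v₀ - p.1)) := by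
        fun_prop
      let G : C(Fin n₀ → ℝ, C(I, X)) := ContinuousMap.curry ⟨_, hF⟩
      have he : ∀ v ∈ sphere (0 : Fin n₀ → ℝ) 1, (h v, G v) = (0, ContinuousMap.const I (φ v)) := by
        intro v hv
        have hv' := mem_sphere_zero_iff_norm.1 hv
        refine Prod.ext ?_ (ContinuousMap.ext fun t => ?_)
        · simp [h, hv']
        · simp [G, τ, hv']
      refine ⟨⟨fun v => (h v, G v), (hh.prodMk G.continuous).comp hval⟩, fun v => ?_,
        fun v hv => ?_⟩
      · rcases hdich v with hv | hv
        · have := hgQ v hv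
          rwa [← (he v hv).trans (hgs v hv).symm] at this
        · refine ⟨by simp [G], fun hp => ?_, fun hvx => ?_, fun h => absurd h (hball' hn v hv)⟩
          · have h1 : 0 < 2 / (1 - ‖v₀‖) * (1 - ‖v.1‖) - 1 := by simpa [h] using hp
            have h2 : τ v = 1 := min_eq_left (by linarith)
            simp only [G, ContinuousMap.curry_apply, ContinuousMap.coe_mk, h2]
            rw [← hx, ← hφ (ball_subset_closedBall hv₀)]
            simp
          · have : v.1 = v₀ := by
              refine (map n₀ i₀).injOn (by rwa [source_eq]) (by rwa [source_eq]) ?_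
              rw [hx, ← hφ v.2, hvx]
            simp only [ContinuousMap.coe_mk, h, this, div_mul_cancel₀ _ hpos.ne']
            norm_num
      · have hv' := mem_sphere_zero_iff_norm.2 hv
        exact (he v hv').trans (hgs v hv').symm
    · refine ⟨⟨fun v => (0, ContinuousMap.const I (φ v)), ?_⟩, fun v => ?_, fun v hv => ?_⟩
      · exact continuous_const.prodMk
          (ContinuousMap.continuous_const'.comp (φ.continuous.comp hval))
      · refine ⟨rfl, fun h => absurd h (lt_irrefl _), fun h => ?_, fun _ => rfl⟩
        rcases hdich v with hv | hv
        · exact absurd (h ▸ hsph v hv) (hxS n hn)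
        · exact absurd (hcell v hv h) hc
      · exact (hgs v (mem_sphere_zero_iff_norm.2 hv)).symm

end CellularContractions

/-! ### Contracting the homotopy fibres of a family of maps homotopic to the identity -/

section DivisionExtension

variable {X : Type*} [TopologicalSpace X] {E : Type*} [TopologicalSpace E]

/-- The space of triples `(v, y, γ)` where `γ` is a path from `m (v, y)` to `e`. -/
abbrev PathsToUnit (m : C(E × X, X)) (e : X) : Type _ :=
  {p : E × X × C(I, X) // p.2.2 0 = m (p.1, p.2.1) ∧ p.2.2 1 = e}

namespace PathsToUnit

variable {m : C(E × X, X)} {e : X} (κ : ∀ p : E × X, Path (m p) p.2)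

/-- The path from `y` to `e` of length `2` that runs backwards through `κ (v, y)` and then
through `γ`. -/
noncomputable def detour (p : PathsToUnit m e) (c : ℝ) : X :=
  if c ≤ 1 then κ (p.1.1, p.1.2.1) (Set.projIcc 0 1 zero_le_one (1 - c))
  else p.1.2.2 (Set.projIcc 0 1 zero_le_one (c - 1))

variable {κ}

theorem continuous_detour (hκ : Continuous ↿κ) :
    Continuous fun q : PathsToUnit m e × ℝ => detour κ q.1 q.2 := by
  have hv : Continuous fun q : PathsToUnit m e × ℝ => q.1.1 :=
    continuous_subtype_val.comp continuous_fst
  refine continuous_if_le continuous_snd continuous_const (Continuous.continuousOn ?_)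
    (Continuous.continuousOn ?_) fun q hq => ?_
  · exact hκ.comp (f := fun q : PathsToUnit m e × ℝ =>
      ((q.1.1.1, q.1.1.2.1), Set.projIcc 0 1 zero_le_one (1 - q.2))) (by fun_prop)
  · exact Continuous.eval (by fun_prop) (by fun_prop)
  · rw [hq, sub_self, Set.projIcc_left]
    exact (κ _).source.trans q.1.2.1.symm

theorem detour_nonpos (p : PathsToUnit m e) {c : ℝ} (hc : c ≤ 0) : detour κ p c = p.1.2.1 := by
  rw [detour, if_pos (by linarith), Set.projIcc_of_right_le _ (by linarith)]
  exact (κ _).target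

theorem detour_two (p : PathsToUnit m e) : detour κ p 2 = e := by
  rw [detour, if_neg (by norm_num), Set.projIcc_of_right_le _ (by norm_num)]
  exact p.2.2

theorem detour_one_add (p : PathsToUnit m e) (t : I) : detour κ p (1 + t) = p.1.2.2 t := by
  rw [detour]
  split_ifs with h
  · have : t = 0 := Subtype.ext (le_antisymm (show (t : ℝ) ≤ 0 by linarith) t.2.1)
    subst this
    simp [p.2.1]
  · rw [add_sub_cancel_left, Set.projIcc_val]

variable (κ) in
/-- The contraction of the fibres of `PathsToUnit m e` over `E`, at the time `τ`, as a pair of a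
point and a path. -/
noncomputable def contract (p : PathsToUnit m e) (τ : ℝ) (t : I) : X :=
  -- Read from `τ = 1` down to `0`. First `s` grows from 0 to 1 while `b = 0`: a back-and-forth
  -- excursion along `κ` is inserted before `γ`. Then `s = 1` and `b` grows from 0 to 2: the point
  -- slides along the detour from `y` to `e`. The path has length `1 + 2 * s - b` and `a` is its
  -- parameter.
  let s := max 0 (min 1 (2 * (1 - τ)))
  let b := max 0 (2 * (1 - 2 * τ))
  let a := t * (1 + 2 * s - b)
  if a ≤ s then κ (p.1.1, detour κ p b) (Set.projIcc 0 1 zero_le_one a)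
  else detour κ p (b + 1 + a - 2 * s)

theorem continuous_contract (hκ : Continuous ↿κ) :
    Continuous fun q : (PathsToUnit m e × ℝ) × I => contract κ q.1.1 q.1.2 q.2 := by
  have hd := continuous_detour (e := e) hκ
  have hv : Continuous fun q : (PathsToUnit m e × ℝ) × I => q.1.1.1.1 :=
    continuous_fst.comp (continuous_subtype_val.comp (continuous_fst.comp continuous_fst))
  have hd' : ∀ f : (PathsToUnit m e × ℝ) × I → ℝ, Continuous f →
      Continuous fun q : (PathsToUnit m e × ℝ) × I => detour κ q.1.1 (f q) := fun f hf =>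
    hd.comp ((continuous_fst.comp continuous_fst).prodMk hf)
  refine continuous_if_le (by fun_prop) (by fun_prop) (Continuous.continuousOn ?_)
    (Continuous.continuousOn (hd' _ (by fun_prop))) fun q hq => ?_
  · exact hκ.comp (f := fun q : (PathsToUnit m e × ℝ) × I => ((q.1.1.1.1,
      detour κ q.1.1 (max 0 (2 * (1 - 2 * q.1.2)))), Set.projIcc 0 1 zero_le_one
        (q.2 * (1 + 2 * max 0 (min 1 (2 * (1 - q.1.2))) - max 0 (2 * (1 - 2 * q.1.2))))))
      ((hv.prodMk (hd' _ (by fun_prop))).prodMk (by fun_prop))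
  · dsimp only
    rw [hq]
    rcases le_or_gt q.1.2 (1 / 2) with h | h
    · have h1 : max 0 (min 1 (2 * (1 - q.1.2))) = 1 := by
        rw [min_eq_left (by linarith), max_eq_right zero_le_one]
      rw [h1, Set.projIcc_right]
      refine (κ _).target.trans ?_
      dsimp only
      congr 1
      ring
    · have h1 : max 0 (2 * (1 - 2 * q.1.2)) = 0 := max_eq_left (by linarith)
      rw [h1, detour_nonpos _ le_rfl, detour]
      set s := max 0 (min 1 (2 * (1 - q.1.2)))
      have hs : s ≤ 1 := max_le zero_le_one (min_le_left _ _)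
      have h0 : 0 ≤ s := le_max_left _ _
      rw [if_pos (by linarith)]
      congr 2
      ring

theorem contract_zero (p : PathsToUnit m e) (τ : ℝ) :
    contract κ p τ 0 = m (p.1.1, detour κ p (max 0 (2 * (1 - 2 * τ)))) := by
  have h : (((0 : I) : ℝ) * (1 + 2 * max 0 (min 1 (2 * (1 - τ))) - max 0 (2 * (1 - 2 * τ)))) = 0 :=
    zero_mul _
  rw [contract, h, if_pos (le_max_left _ _), Set.projIcc_left]
  exact (κ _).source

theorem contract_one (p : PathsToUnit m e) {τ : ℝ} (hτ : 0 ≤ τ) :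
    contract κ p τ 1 = e := by
  rw [contract, Set.Icc.coe_one, one_mul]
  split_ifs with h
  · rcases le_or_gt τ (1 / 2) with h' | h'
    · have hs : max 0 (min 1 (2 * (1 - τ))) = 1 := by
        rw [min_eq_left (by linarith), max_eq_right zero_le_one]
      have hb : max 0 (2 * (1 - 2 * τ)) = 2 := by
        refine le_antisymm (max_le (by norm_num) (by linarith)) ?_
        rw [hs] at h
        linarith
      rw [hs, hb, detour_two, Set.projIcc_of_right_le _ (by norm_num)]
      exact (κ _).target
    · rw [max_eq_left (by linarith : 2 * (1 - 2 * τ) ≤ 0)] at h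
      linarith [le_max_left 0 (min 1 (2 * (1 - τ)))]
  · refine Eq.trans ?_ (detour_two (κ := κ) p)
    congr 1
    ring

theorem contract_apply_zero (p : PathsToUnit m e) (t : I) :
    contract κ p 0 t = κ (p.1.1, e) t := by
  have hs : max 0 (min 1 (2 * (1 - (0 : ℝ)))) = 1 := by norm_num
  have hb : max 0 (2 * (1 - 2 * (0 : ℝ))) = 2 := by norm_num
  have ha : (t : ℝ) * (1 + 2 * 1 - 2) = t := by ring
  rw [contract, hs, hb, ha, if_pos t.2.2, detour_two, Set.projIcc_val]

theorem contract_apply_one (p : PathsToUnit m e) (t : I) :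
    contract κ p 1 t = p.1.2.2 t := by
  have hs : max 0 (min 1 (2 * (1 - (1 : ℝ)))) = 0 := by norm_num
  have hb : max 0 (2 * (1 - 2 * (1 : ℝ))) = 0 := by norm_num
  have ha : (t : ℝ) * (1 + 2 * 0 - 0) = t := by ring
  rw [contract, hs, hb, ha]
  split_ifs with h
  · have : t = 0 := le_antisymm h t.2.1
    subst this
    rw [detour_nonpos _ le_rfl, p.2.1, Set.Icc.coe_zero, Set.projIcc_left]
    exact (κ _).source
  · rw [← detour_one_add (κ := κ) p t]
    congr 1
    ring

end PathsToUnit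

end DivisionExtension

/-! ### Extending homotopy solutions from the sphere to the ball -/

section DivisionExtension

theorem continuous_dite_le_const {Y Z : Type*} [TopologicalSpace Y] [TopologicalSpace Z] {f : Y → ℝ}
    (hf : Continuous f) {c : ℝ} {a : Y → Z} (ha : Continuous a) {b : {y // c ≤ f y} → Z}
    (hb : Continuous b) (hab : ∀ y (h : f y = c), a y = b ⟨y, h.ge⟩) :
    Continuous fun y => if h : f y ≤ c then a y else b ⟨y, (not_le.1 h).le⟩ := by
  classical
  let b' : Y → Z := fun y => if h : c ≤ f y then b ⟨y, h⟩ else a y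
  have hb' : ContinuousOn b' {y | c ≤ f y} := by
    rw [continuousOn_iff_continuous_domRestrict]
    refine hb.congr fun y => ?_
    have h : c ≤ f y.1 := y.2
    simp [b', h]
  have h := continuous_if_le hf continuous_const ha.continuousOn hb' fun y hy =>
    by
    simp only [b', dif_pos hy.ge, hab y hy]
  refine h.congr fun y => ?_
  split_ifs with h
  · rfl
  · simp only [b', dif_pos (not_le.1 ‹_›).le]

variable {X : Type*} [TopologicalSpace X] {E : Type*} [NormedAddCommGroup E] [NormedSpace ℝ E]

open Metric PathsToUnit

/-- Suppose that the maps `m (v, ·)` are homotopic to the identity. Then solutions `y` of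
`m (v, y) = e` up to homotopy extend from the unit sphere to the unit ball. -/
theorem exists_extend_paths_to_unit (m : C(E × X, X)) (e : X) (κ : ∀ p : E × X, Path (m p) p.2)
    (hκ : Continuous ↿κ) {g : E → X × C(I, X)} (hg : ContinuousOn g (sphere 0 1))
    (hgQ : ∀ v ∈ sphere (0 : E) 1, (g v).2 0 = m (v, (g v).1) ∧ (g v).2 1 = e) :
    ∃ G : C(E, X × C(I, X)), (∀ v, ‖v‖ ≤ 1 → (G v).2 0 = m (v, (G v).1) ∧ (G v).2 1 = e) ∧
      Set.EqOn G g (sphere 0 1) := by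
  let S := {v : E // 1 / 2 ≤ ‖v‖}
  have hS : ∀ v : S, 0 < ‖v.1‖ := fun v => lt_of_lt_of_le (by norm_num) v.2
  have hw : ∀ v : S, ‖v.1‖⁻¹ • v.1 ∈ sphere (0 : E) 1 := by
    intro v
    rw [mem_sphere_zero_iff_norm, norm_smul, norm_inv, norm_norm, inv_mul_cancel₀ (hS v).ne']
  have hwc : Continuous fun v : S => ‖v.1‖⁻¹ • v.1 :=
    (continuous_subtype_val.norm.inv₀ fun v => (hS v).ne').smul continuous_subtype_val
  let p : S → PathsToUnit m e := fun v => ⟨(‖v.1‖⁻¹ • v.1, g (‖v.1‖⁻¹ • v.1)), hgQ _ (hw v)⟩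
  have hp : Continuous p := (hwc.prodMk (hg.comp_continuous hwc hw)).subtype_mk _
  let τ : S → ℝ := fun v => min 1 (2 * ‖v.1‖ - 1)
  have hτ : Continuous τ := by fun_prop
  -- On the inner half of the ball the canonical solution `y = e` is used, at the parameter `2 • v`.
  -- It matches the contracted solution (`τ = 0`) at radius `1 / 2`.
  let a : E → X × C(I, X) := fun v => (e, ⟨fun t => κ ((2 : ℝ) • v, e) t, (κ _).continuous⟩)
  have ha : Continuous a := by
    have h : Continuous fun q : E × I => κ ((2 : ℝ) • q.1, e) q.2 :=
      hκ.comp (f := fun q : E × I => (((2 : ℝ) • q.1, e), q.2)) (by fun_prop)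
    exact continuous_const.prodMk (ContinuousMap.curry ⟨_, h⟩).continuous
  have hbc : Continuous fun q : S × I => contract κ (p q.1) (τ q.1) q.2 :=
    (continuous_contract hκ).comp (f := fun q : S × I => ((p q.1, τ q.1), q.2)) (by fun_prop)
  let b : S → X × C(I, X) := fun v =>
    (detour κ (p v) (max 0 (2 * (1 - 2 * τ v))), ContinuousMap.curry ⟨_, hbc⟩ v)
  have hb : Continuous b := by
    refine Continuous.prodMk ?_ (ContinuousMap.continuous _)
    exact (continuous_detour hκ).comp
      (f := fun v : S => (p v, max 0 (2 * (1 - 2 * τ v)))) (by fun_prop)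
  have hab : ∀ (v : E) (h : ‖v‖ = 1 / 2), a v = b ⟨v, h.ge⟩ := by
    intro v h
    have h0 : τ ⟨v, h.ge⟩ = 0 := by
      simp only [τ, h]
      norm_num
    have h2 : max 0 (2 * (1 - 2 * (0 : ℝ))) = 2 := by norm_num
    refine Prod.ext ?_ (ContinuousMap.ext fun t => ?_)
    · simp only [a, b, h0]
      rw [h2, detour_two]
    · simp only [a, b, ContinuousMap.curry_apply, ContinuousMap.coe_mk, h0]
      rw [contract_apply_zero]
      have h2' : ‖v‖⁻¹ = 2 := by
        rw [h]
        norm_num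
      change κ ((2 : ℝ) • v, e) t = κ (‖v‖⁻¹ • v, e) t
      rw [h2']
  let Γ : E → X × C(I, X) := fun v => if h : ‖v‖ ≤ 1 / 2 then a v else b ⟨v, (not_le.1 h).le⟩
  have hΓ : Continuous Γ := continuous_dite_le_const continuous_norm ha hb hab
  -- `Γ` solves the equation at the stretched parameter `c v • v` rather than at `v`.
  let c : E → ℝ := fun v => (max ‖v‖ (1 / 2))⁻¹
  have hc : Continuous c := by
    have h : Continuous fun v : E => max ‖v‖ (1 / 2) := by fun_prop
    exact h.inv₀ fun v => (lt_of_lt_of_le (by norm_num) (le_max_right _ _)).ne'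
  have hΓ0 : ∀ v, (Γ v).2 0 = m (c v • v, (Γ v).1) := by
    intro v
    by_cases h : ‖v‖ ≤ 1 / 2
    · simp only [Γ, dif_pos h, a, c, max_eq_right h]
      norm_num
    · have hle := (not_le.1 h).le
      simp only [Γ, dif_neg h, b, c, max_eq_left hle]
      exact contract_zero _ _
  have hΓ1 : ∀ v, (Γ v).2 1 = e := by
    intro v
    by_cases h : ‖v‖ ≤ 1 / 2
    · simp only [Γ, dif_pos h, a]
      exact (κ _).target
    · simp only [Γ, dif_neg h, b]
      refine contract_one _ (le_min zero_le_one ?_)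
      dsimp only
      linarith [not_le.1 h]
  have hΓs : ∀ v ∈ sphere (0 : E) 1, Γ v = g v := by
    intro v hv
    have hv1 : ‖v‖ = 1 := mem_sphere_zero_iff_norm.1 hv
    have h : ¬ ‖v‖ ≤ 1 / 2 := by rw [hv1]; norm_num
    have hτ1 : τ ⟨v, (not_le.1 h).le⟩ = 1 := by
      simp only [τ, hv1]
      norm_num
    simp only [Γ, dif_neg h, b]
    refine Prod.ext ?_ (ContinuousMap.ext fun t => ?_)
    · simp only [hτ1]
      rw [detour_nonpos _ (by norm_num)]
      simp [p, hv1]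
    · simp only [ContinuousMap.curry_apply, ContinuousMap.coe_mk, hτ1]
      rw [contract_apply_one]
      simp [p, hv1]
  -- The mismatch is repaired by first moving the parameter from `v` out to `c v • v` with `y`
  -- fixed. On the sphere `c = 1`, so nothing is prepended.
  have hF : Continuous fun q : E × I => if q.2 * c q.1 ≤ c q.1 - 1 then
      m ((1 + q.2 * c q.1) • q.1, (Γ q.1).1) else
        (Γ q.1).2 (Set.projIcc 0 1 zero_le_one (q.2 * c q.1 - (c q.1 - 1))) := by
    refine Continuous.if_le ?_ ?_ (by fun_prop) (by fun_prop) fun q hq => ?_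
    · fun_prop
    · exact Continuous.eval (by fun_prop) (by fun_prop)
    · have : 1 + (q.2 * c q.1) = c q.1 := by rw [hq]; ring
      rw [this, hq, sub_self, Set.projIcc_left]
      exact (hΓ0 q.1).symm
  refine ⟨⟨fun v => ((Γ v).1, ContinuousMap.curry ⟨_, hF⟩ v),
    (continuous_fst.comp hΓ).prodMk (ContinuousMap.continuous _)⟩, fun v hv => ⟨?_, ?_⟩,
    fun v hv => ?_⟩
  · have h1 : 1 ≤ c v := one_le_inv_iff₀.2
      ⟨lt_of_lt_of_le (by norm_num) (le_max_right _ _), max_le hv (by norm_num)⟩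
    simp [h1]
  · have h1 : ¬ c v ≤ c v - 1 := by linarith
    simp only [ContinuousMap.coe_mk, ContinuousMap.curry_apply, Set.Icc.coe_one, one_mul]
    rw [if_neg h1, sub_sub_cancel, Set.projIcc_right]
    exact hΓ1 v
  · have hc1 : c v = 1 := by
      simp only [c, mem_sphere_zero_iff_norm.1 hv]
      norm_num
    rw [← hΓs v hv]
    refine Prod.ext rfl (ContinuousMap.ext fun t => ?_)
    simp only [ContinuousMap.coe_mk, ContinuousMap.curry_apply, hc1, mul_one, sub_self, sub_zero,
      Set.projIcc_val]
    split_ifs with h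
    · have : t = 0 := le_antisymm h t.2.1
      subst this
      rw [hΓ0 v, hc1]
      simp
    · rfl

end DivisionExtension

/-! ### Homotopy inverses in H-spaces -/

section HSpaceInverse

variable {X : Type*} [TopologicalSpace X] [T2Space X] [CWComplex (Set.univ : Set X)] [HSpace X]
  [PathConnectedSpace X]

/-- An H-space that is a path-connected CW complex has a right inverse up to homotopy. -/
theorem HSpace.exists_right_inverse : ∃ f : C(X, X × C(I, X)), ∀ x,
    (f x).2 0 = HSpace.hmul (x, (f x).1) ∧ (f x).2 1 = HSpace.e := by
  have : Nonempty (X × C(I, X)) := ⟨HSpace.e, ContinuousMap.const I HSpace.e⟩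
  refine CWComplex.exists_continuous_section' (fun x (z : X × C(I, X)) =>
    z.2 0 = HSpace.hmul (x, z.1) ∧ z.2 1 = HSpace.e) fun n i φ _ g hg hgQ => ?_
  let m : C((Fin n → ℝ) × X, X) := HSpace.hmul.comp (φ.prodMap (ContinuousMap.id X))
  -- Multiplication by `φ v` is deformed to the identity in three stages: contract the cell to its
  -- centre, move `φ 0` to the unit, then use the homotopy unit law.
  let α : ∀ p : (Fin n → ℝ) × X, Path (m p) (HSpace.hmul (φ 0, p.2)) := fun p =>
    { toFun := fun t => HSpace.hmul (φ ((1 - t : ℝ) • p.1), p.2)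
      continuous_toFun := by fun_prop
      source' := by simp [m, Prod.map]
      target' := by simp }
  let γ : Path (φ 0) (HSpace.e : X) := PathConnectedSpace.somePath _ _
  let β : ∀ p : (Fin n → ℝ) × X, Path (HSpace.hmul (φ 0, p.2)) (HSpace.hmul (HSpace.e, p.2)) :=
    fun p =>
    { toFun := fun t => HSpace.hmul (γ t, p.2)
      continuous_toFun := by fun_prop
      source' := by simp
      target' := by simp }
  let ε : ∀ p : (Fin n → ℝ) × X, Path (HSpace.hmul (HSpace.e, p.2)) p.2 := fun p =>
    { toFun := fun t => HSpace.eHmul (t, p.2)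
      continuous_toFun := by fun_prop
      source' := HSpace.eHmul.apply_zero p.2
      target' := HSpace.eHmul.apply_one p.2 }
  have hα : Continuous ↿α := by
    change Continuous fun q : ((Fin n → ℝ) × X) × I =>
      HSpace.hmul (φ ((1 - q.2 : ℝ) • q.1.1), q.1.2)
    fun_prop
  have hβ : Continuous ↿β := by
    change Continuous fun q : ((Fin n → ℝ) × X) × I => HSpace.hmul (γ q.2, q.1.2)
    fun_prop
  have hε : Continuous ↿ε := by
    change Continuous fun q : ((Fin n → ℝ) × X) × I => HSpace.eHmul (q.2, q.1.2)
    fun_prop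
  obtain ⟨G, hG, hGe⟩ := exists_extend_paths_to_unit m HSpace.e
    (fun p => ((α p).trans (β p)).trans (ε p))
    (Path.trans_continuous_family _ (Path.trans_continuous_family _ hα _ hβ) _ hε) hg hgQ
  exact ⟨G.comp ⟨Subtype.val, continuous_subtype_val⟩,
    fun v => hG v (mem_closedBall_zero_iff.1 v.2),
    fun v hv => hGe (mem_sphere_zero_iff_norm.2 hv)⟩

end HSpaceInverse

/-! ### The covering space with the topology generated by sheets -/

section SheetTopology

theorem isLocalHomeomorph_of_isOpenMap_of_isLocallyInjective {E B : Type*} [TopologicalSpace E]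
    [TopologicalSpace B] {p : E → B} (hc : Continuous p) (ho : IsOpenMap p)
    (hi : IsLocallyInjective p) : IsLocalHomeomorph p := by
  rw [isLocalHomeomorph_iff_isOpenEmbedding_restrict]
  intro x
  obtain ⟨U, hU, hx, hUi⟩ := hi x
  exact ⟨U, hU.mem_nhds hx, .of_continuous_injective_isOpenMap
    (hc.comp continuous_subtype_val) hUi.injective (ho.comp hU.isOpenMap_subtype_val)⟩

variable {Y : Type*} [TopologicalSpace Y]

/-- An open neighbourhood of `z` with a contraction to `z` inside the whole space. -/
structure ContractingNhd (z : Y) where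
  /-- The underlying set. -/
  carrier : Set Y
  isOpen : IsOpen carrier
  mem : z ∈ carrier
  /-- The contraction. -/
  homotopy : (⟨Subtype.val, continuous_subtype_val⟩ : C(carrier, Y)).Homotopy
    (ContinuousMap.const carrier z)

theorem LocallyContractsInside.nonempty_contractingNhd (h : LocallyContractsInside Y) (z : Y) :
    Nonempty (ContractingNhd z) := by
  obtain ⟨V, hV, H, h0, h1⟩ := h z
  exact ⟨⟨interior V, isOpen_interior, mem_interior_iff_mem_nhds.2 hV,
    { toFun := fun q => H q.2.1 q.1
      continuous_toFun := Continuous.eval (by fun_prop) (by fun_prop)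
      map_zero_left := fun y => h0 y.1
      map_one_left := fun y => h1 y.1 (interior_subset y.2) }⟩⟩

/-- The class of the path that the contraction provides. -/
def ContractingNhd.cls {z : Y} (N : ContractingNhd z) (y : N.carrier) :
    Path.Homotopic.Quotient y.1 z :=
  .mk (N.homotopy.evalAt y)

/-- Naturality of the contraction, whose final map is constant. Thus classes are transported
consistently inside the neighbourhood although it need not be simply connected. -/
theorem ContractingNhd.map_trans_cls {z : Y} (N : ContractingNhd z) {y y' : N.carrier}
    (c : Path y y') :
    (Path.Homotopic.Quotient.mk (c.map continuous_subtype_val)).trans (N.cls y') = N.cls y := by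
  have h := Path.Homotopic.map_trans_evalAt N.homotopy c
  have h' : c.map (map_continuous (ContinuousMap.const N.carrier z)) = Path.refl z := by
    ext t
    rfl
  rw [h'] at h
  exact (Path.Homotopic.Quotient.eq.2 h).trans (Path.Homotopic.Quotient.trans_refl (N.cls y))

/-- The underlying set of the universal covering space, to be given the topology that is generated
by sheets. -/
def SheetCover (y₀ : Y) : Type _ := UniversalCover y₀

namespace SheetCover

variable {y₀ : Y}

/-- The sheet through `g` over a contracting neighbourhood. -/
noncomputable def sheet {z : Y} (N : ContractingNhd z) (g : Path.Homotopic.Quotient z y₀) (y : N.carrier) :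
    SheetCover y₀ :=
  ⟨y.1, (N.cls y).trans g⟩

/-- The final topology for all sheets, so that openness is tested sheet by sheet. That sheets are
open is a separate fact, which uses local path-connectedness. -/
noncomputable instance : TopologicalSpace (SheetCover y₀) :=
  ⨆ (z : Y) (N : ContractingNhd z) (g : Path.Homotopic.Quotient z y₀),
    TopologicalSpace.coinduced (sheet N g) inferInstance

theorem isOpen_iff {U : Set (SheetCover y₀)} : IsOpen U ↔
    ∀ (z : Y) (N : ContractingNhd z) (g : Path.Homotopic.Quotient z y₀),
      IsOpen (sheet N g ⁻¹' U) := by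
  simp only [isOpen_iSup_iff, isOpen_coinduced]

/-- The projection of the covering space. -/
def proj (w : SheetCover y₀) : Y := w.1

theorem mk_eq_mk {y : Y} {a b : Path.Homotopic.Quotient y y₀} :
    (⟨y, a⟩ : SheetCover y₀) = ⟨y, b⟩ ↔ a = b :=
  ⟨fun h => eq_of_heq (Sigma.ext_iff.1 h).2, fun h => h ▸ rfl⟩

theorem sheet_eq_self {y : Y} (N : ContractingNhd y) (a : Path.Homotopic.Quotient y y₀) :
    sheet N ((N.cls ⟨y, N.mem⟩).symm.trans a) ⟨y, N.mem⟩ = ⟨y, a⟩ := by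
  refine mk_eq_mk.2 ?_
  rw [← Path.Homotopic.Quotient.trans_assoc, Path.Homotopic.Quotient.trans_symm,
    Path.Homotopic.Quotient.refl_trans]

theorem trans_left_cancel {x y z : Y} (a : Path.Homotopic.Quotient x y)
    {b c : Path.Homotopic.Quotient y z} (h : a.trans b = a.trans c) : b = c := by
  have := congrArg (a.symm.trans ·) h
  simpa [← Path.Homotopic.Quotient.trans_assoc] using this

/-- Sheets that agree at one point agree along paths in the intersection of their bases. -/
theorem sheet_eq_of_joinedIn {z z' : Y} {N : ContractingNhd z} {N' : ContractingNhd z'}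
    {g : Path.Homotopic.Quotient z y₀} {g' : Path.Homotopic.Quotient z' y₀} {y w : Y}
    (hj : JoinedIn (N.carrier ∩ N'.carrier) y w)
    (h : sheet N g ⟨y, hj.source_mem.1⟩ = sheet N' g' ⟨y, hj.source_mem.2⟩) :
    sheet N g ⟨w, hj.target_mem.1⟩ = sheet N' g' ⟨w, hj.target_mem.2⟩ := by
  obtain ⟨c, hc⟩ := id hj
  have h1 := N.map_trans_cls (y := ⟨y, hj.source_mem.1⟩) (y' := ⟨w, hj.target_mem.1⟩)
    { toFun := fun t => ⟨c t, (hc t).1⟩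
      continuous_toFun := by fun_prop
      source' := Subtype.ext c.source
      target' := Subtype.ext c.target }
  have h2 := N'.map_trans_cls (y := ⟨y, hj.source_mem.2⟩) (y' := ⟨w, hj.target_mem.2⟩)
    { toFun := fun t => ⟨c t, (hc t).2⟩
      continuous_toFun := by fun_prop
      source' := Subtype.ext c.source
      target' := Subtype.ext c.target }
  have h3 := mk_eq_mk.1 h
  rw [← h1, ← h2, Path.Homotopic.Quotient.trans_assoc, Path.Homotopic.Quotient.trans_assoc] at h3
  exact mk_eq_mk.2 (trans_left_cancel _ h3)

theorem continuous_proj : Continuous (proj : SheetCover y₀ → Y) := by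
  refine ⟨fun U hU => isOpen_iff.2 fun z N g => ?_⟩
  exact hU.preimage continuous_subtype_val

theorem isOpenMap_proj (hY : LocallyContractsInside Y) :
    IsOpenMap (proj : SheetCover y₀ → Y) := by
  intro U hU
  rw [isOpen_iff_mem_nhds]
  rintro _ ⟨⟨y, a⟩, ha, rfl⟩
  obtain ⟨N⟩ := hY.nonempty_contractingNhd y
  have h := isOpen_iff.1 hU y N ((N.cls ⟨y, N.mem⟩).symm.trans a)
  refine Filter.mem_of_superset ((N.isOpen.isOpenMap_subtype_val _ h).mem_nhds
    ⟨⟨y, N.mem⟩, ?_, rfl⟩) ?_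
  · rw [Set.mem_preimage, sheet_eq_self]
    exact ha
  · rintro _ ⟨v, hv, rfl⟩
    exact ⟨_, hv, rfl⟩

theorem disjoint_range_sheet {z : Y} (N : ContractingNhd z) {g g' : Path.Homotopic.Quotient z y₀}
    (h : g ≠ g') : Disjoint (Set.range (sheet N g)) (Set.range (sheet N g')) := by
  rw [Set.disjoint_left]
  rintro _ ⟨u, rfl⟩ ⟨v, hv⟩
  obtain rfl : v = u := Subtype.ext (congrArg proj hv)
  exact h (trans_left_cancel _ (mk_eq_mk.1 hv)).symm

variable [LocallyPathConnectedSpace Y]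

/-- Two sheets that meet over a point agree on its path component in the intersection of their
bases, and this is a neighbourhood of the point. -/
theorem isOpenMap_sheet {z : Y} (N : ContractingNhd z) (g : Path.Homotopic.Quotient z y₀) :
    IsOpenMap (sheet N g) := by
  intro O hO
  rw [isOpen_iff]
  intro z' N' g'
  rw [isOpen_iff_mem_nhds]
  rintro ⟨y, hy'⟩ ⟨⟨w, hw⟩, hwO, hwy⟩
  obtain rfl : w = y := congrArg proj hwy
  obtain ⟨O', hO', rfl⟩ := isOpen_induced_iff.1 hO
  have hn : pathComponentIn (N.carrier ∩ N'.carrier ∩ O') w ∈ 𝓝 w :=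
    pathComponentIn_mem_nhds (((N.isOpen.inter N'.isOpen).inter hO').mem_nhds ⟨⟨hw, hy'⟩, hwO⟩)
  filter_upwards [continuous_subtype_val.continuousAt.preimage_mem_nhds hn]
  rintro ⟨v, hv'⟩ (hv : JoinedIn _ w v)
  have hj : JoinedIn (N.carrier ∩ N'.carrier) w v := hv.mono Set.inter_subset_left
  exact ⟨⟨v, hj.target_mem.1⟩, hv.target_mem.2, sheet_eq_of_joinedIn hj hwy⟩

theorem isLocallyInjective_proj (hY : LocallyContractsInside Y) :
    IsLocallyInjective (proj : SheetCover y₀ → Y) := by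
  rintro ⟨y, a⟩
  obtain ⟨N⟩ := hY.nonempty_contractingNhd y
  refine ⟨Set.range (sheet N ((N.cls ⟨y, N.mem⟩).symm.trans a)), (isOpenMap_sheet _ _).isOpen_range,
    ⟨_, sheet_eq_self N a⟩, ?_⟩
  rintro _ ⟨u, rfl⟩ _ ⟨v, rfl⟩ h
  rw [Subtype.ext h]

theorem isLocalHomeomorph_proj (hY : LocallyContractsInside Y) :
    IsLocalHomeomorph (proj : SheetCover y₀ → Y) :=
  isLocalHomeomorph_of_isOpenMap_of_isLocallyInjective continuous_proj (isOpenMap_proj hY)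
    (isLocallyInjective_proj hY)

/-- Two points of one fibre lie on sheets over the same contracting neighbourhood, and such sheets
are disjoint unless equal. -/
theorem isSeparatedMap_proj (hY : LocallyContractsInside Y) :
    IsSeparatedMap (proj : SheetCover y₀ → Y) := by
  rintro ⟨y, a⟩ ⟨y', b⟩ (rfl : y = y') hne
  obtain ⟨N⟩ := hY.nonempty_contractingNhd y
  refine ⟨_, _, (isOpenMap_sheet N _).isOpen_range, (isOpenMap_sheet N _).isOpen_range,
    ⟨_, sheet_eq_self N a⟩, ⟨_, sheet_eq_self N b⟩, disjoint_range_sheet N fun h => hne ?_⟩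
  rw [trans_left_cancel _ h]

end SheetCover

end SheetTopology

/-! ### The sheet topology is the quotient of the compact-open topology -/

section UniversalCoverTopology

variable {Y : Type*} [TopologicalSpace Y] {y₀ : Y}

namespace SheetCover

instance : ContractibleSpace I := (convex_Icc (0 : ℝ) 1).contractibleSpace ⟨0, by simp⟩

instance : LocallyPathConnectedSpace I := by
  refine Topology.IsQuotientMap.locallyPathConnectedSpace
    (f := Set.projIcc (0 : ℝ) 1 zero_le_one) ?_
  exact .of_inverse continuous_subtype_val continuous_projIcc
    fun x => Set.projIcc_val zero_le_one x

/-- The interval is simply connected, so `default` names the class from `a` to `b`; end segments of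
paths are its images, with no reparametrization. -/
noncomputable instance (a b : I) : Unique (Path.Homotopic.Quotient a b) :=
  { default := .mk (PathConnectedSpace.somePath a b)
    uniq := fun _ => Subsingleton.elim _ _ }

/-- The class of the end segment of a path, from the time `a`. -/
noncomputable def pathLift (γ : BasedPath y₀) (a : I) : SheetCover y₀ :=
  ⟨γ.1 a, ((default : Path.Homotopic.Quotient a 1).map γ.1).cast rfl γ.2.symm⟩

theorem map_trans {Z : Type*} [TopologicalSpace Z] (f : C(Z, Y)) {a b c : Z}
    (u : Path.Homotopic.Quotient a b) (v : Path.Homotopic.Quotient b c) :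
    (u.trans v).map f = (u.map f).trans (v.map f) := by
  induction u using Path.Homotopic.Quotient.ind with | mk u =>
  induction v using Path.Homotopic.Quotient.ind with | mk v =>
  exact congrArg Path.Homotopic.Quotient.mk (Path.map_trans u v f.continuous)

theorem pathLift_zero (γ : BasedPath y₀) : pathLift γ 0 = UniversalCover.ofPath γ := by
  obtain ⟨γ, rfl⟩ := γ
  refine mk_eq_mk.2 ?_
  rw [Subsingleton.elim (default : Path.Homotopic.Quotient (0 : I) 1)
    (.mk ⟨ContinuousMap.id I, rfl, rfl⟩)]
  rfl

theorem pathLift_one (γ : BasedPath y₀) : pathLift γ 1 = (⟨y₀, .refl y₀⟩ : SheetCover y₀) := by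
  obtain ⟨γ, rfl⟩ := γ
  refine mk_eq_mk.2 ?_
  rw [Subsingleton.elim (default : Path.Homotopic.Quotient (1 : I) 1) (.refl 1)]
  rfl

theorem map_default_eq (γ : C(I, Y)) (a₀ : I) (N : ContractingNhd (γ a₀)) {a : I}
    (hj : JoinedIn (γ ⁻¹' N.carrier) a a₀) :
    (default : Path.Homotopic.Quotient a 1).map γ =
      (N.cls ⟨γ a, hj.source_mem⟩).trans ((N.cls ⟨γ a₀, N.mem⟩).symm.trans
        ((default : Path.Homotopic.Quotient a₀ 1).map γ)) := by
  obtain ⟨c, hc⟩ := id hj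
  have h1 := N.map_trans_cls (y := ⟨γ a, hj.source_mem⟩) (y' := ⟨γ a₀, N.mem⟩)
    { toFun := fun t => ⟨γ (c t), hc t⟩
      continuous_toFun := by fun_prop
      source' := Subtype.ext (congrArg γ c.source)
      target' := Subtype.ext (congrArg γ c.target) }
  have h2 : (default : Path.Homotopic.Quotient a 1) =
      (Path.Homotopic.Quotient.mk c).trans (default : Path.Homotopic.Quotient a₀ 1) :=
    Subsingleton.elim _ _
  rw [← h1, Path.Homotopic.Quotient.trans_assoc,
    ← Path.Homotopic.Quotient.trans_assoc (N.cls _) (N.cls _).symm,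
    Path.Homotopic.Quotient.trans_symm, Path.Homotopic.Quotient.refl_trans, h2, map_trans]
  rfl

theorem pathLift_eq_sheet (γ : BasedPath y₀) (a₀ : I) (N : ContractingNhd (γ.1 a₀)) {a : I}
    (hj : JoinedIn (γ.1 ⁻¹' N.carrier) a a₀) :
    pathLift γ a = sheet N ((N.cls ⟨γ.1 a₀, N.mem⟩).symm.trans (pathLift γ a₀).2)
      ⟨γ.1 a, hj.source_mem⟩ := by
  obtain ⟨γ, rfl⟩ := γ
  exact mk_eq_mk.2 (map_default_eq γ a₀ N hj)

theorem continuous_pathLift (hY : LocallyContractsInside Y) (γ : BasedPath y₀) :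
    Continuous (pathLift γ) := by
  refine ⟨fun U hU => isOpen_iff_mem_nhds.2 fun a₀ ha₀ => ?_⟩
  obtain ⟨N⟩ := hY.nonempty_contractingNhd (γ.1 a₀)
  obtain ⟨O, hO, hOU⟩ := isOpen_induced_iff.1
    (isOpen_iff.1 hU _ N ((N.cls ⟨γ.1 a₀, N.mem⟩).symm.trans (pathLift γ a₀).2))
  have h0 : γ.1 a₀ ∈ O := by
    have : (⟨γ.1 a₀, N.mem⟩ : N.carrier) ∈ Subtype.val ⁻¹' O := by
      have hs : sheet N _ _ = pathLift γ a₀ := sheet_eq_self N (pathLift γ a₀).2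
      rw [hOU, Set.mem_preimage, hs]
      exact ha₀
    exact this
  filter_upwards [(hO.preimage γ.1.continuous).mem_nhds h0, pathComponentIn_mem_nhds
    ((N.isOpen.preimage γ.1.continuous).mem_nhds N.mem)] with a haO haj
  have hj : JoinedIn (γ.1 ⁻¹' N.carrier) a₀ a := haj
  rw [Set.mem_preimage, pathLift_eq_sheet γ a₀ N hj.symm]
  have : (⟨γ.1 a, hj.target_mem⟩ : N.carrier) ∈ Subtype.val ⁻¹' O := haO
  rwa [hOU] at this

/-- The map that sends a path ending at `y₀` to its homotopy class. -/
def ofPath (γ : BasedPath y₀) : SheetCover y₀ := UniversalCover.ofPath γ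

/-- The class of the constant path. -/
def base (y₀ : Y) : SheetCover y₀ := ⟨y₀, .refl y₀⟩

/-- The end segments of a path lift it to the covering. For a separated local homeomorphism a lift
is jointly continuous once it is continuous in time and at the initial time. Time is reversed
because the common known value is the constant class at the end point. -/
theorem continuous_ofPath [LocallyPathConnectedSpace Y] (hY : LocallyContractsInside Y) :
    Continuous (ofPath : BasedPath y₀ → SheetCover y₀) := by
  have hv : Continuous fun γ : BasedPath y₀ => γ.1 := continuous_subtype_val
  let f : C(I × BasedPath y₀, Y) := ⟨fun q => q.2.1 (σ q.1), Continuous.eval (by fun_prop)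
    (by fun_prop)⟩
  have h := (isLocalHomeomorph_proj (y₀ := y₀) hY).continuous_lift (isSeparatedMap_proj hY) f
    (g := fun q => pathLift q.2 (σ q.1)) rfl ?_ ?_
  · have h1 := h.comp (Continuous.prodMk_right (1 : I))
    refine h1.congr fun γ => ?_
    simp only [Function.comp_apply, unitInterval.symm_one]
    exact pathLift_zero γ
  · refine continuous_const.congr (f := fun _ => base y₀) fun γ => ?_
    simp only [unitInterval.symm_zero]
    exact (pathLift_one γ).symm
  · exact fun γ => (continuous_pathLift hY γ).comp unitInterval.continuous_symm

/-- Paths that represent the points of a sheet, continuously. -/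
theorem exists_path_sheet {z : Y} (N : ContractingNhd z) (g : Path.Homotopic.Quotient z y₀) :
    ∃ s : C(N.carrier, BasedPath y₀), ∀ y, UniversalCover.ofPath (s y) = sheet N g y := by
  obtain ⟨g, rfl⟩ := Path.Homotopic.Quotient.mk_surjective g
  have hH : Continuous ↿(fun y : N.carrier => (N.homotopy.evalAt y : Path y.1 z)) := by
    change Continuous fun q : N.carrier × I => N.homotopy (q.2, q.1)
    fun_prop
  have hg : Continuous ↿(fun _ : N.carrier => g) := by
    change Continuous fun q : N.carrier × I => g q.2
    fun_prop
  have ht := Path.trans_continuous_family _ hH _ hg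
  let s : C(N.carrier, C(I, Y)) := ContinuousMap.curry ⟨_, ht⟩
  refine ⟨⟨fun y => ⟨s y, Path.target ((N.homotopy.evalAt y : Path y.1 z).trans g)⟩, s.continuous.subtype_mk _⟩, fun y => ?_⟩
  have h0 : s y 0 = y.1 :=
    Path.source ((N.homotopy.evalAt y : Path y.1 z).trans g)
  refine Sigma.ext h0 ?_
  exact Path.Homotopic.hpath_hext fun t => rfl

/-- In a locally path-connected space with contracting neighbourhoods, the topology that is
generated by sheets is the quotient topology. -/
noncomputable def homeomorphUniversalCover [LocallyPathConnectedSpace Y]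
    (hY : LocallyContractsInside Y) : UniversalCover y₀ ≃ₜ SheetCover y₀ where
  toFun w := w
  invFun w := w
  left_inv _ := rfl
  right_inv _ := rfl
  continuous_toFun := continuous_coinduced_dom.2 (continuous_ofPath hY)
  continuous_invFun := by
    refine ⟨fun U hU => isOpen_iff.2 fun z N g => ?_⟩
    obtain ⟨s, hs⟩ := exists_path_sheet N g
    have h1 : Continuous fun y => UniversalCover.ofPath (s y) :=
      (continuous_coinduced_rng : Continuous (UniversalCover.ofPath : BasedPath y₀ → _)).comp
        s.continuous
    have h2 := hU.preimage h1
    simp only [hs] at h2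
    exact h2

end SheetCover

namespace UniversalCover

variable [LocallyPathConnectedSpace Y] (hY : LocallyContractsInside Y)

include hY

theorem isLocalHomeomorph_proj : IsLocalHomeomorph (proj : UniversalCover y₀ → Y) :=
  (SheetCover.isLocalHomeomorph_proj hY).comp
    (SheetCover.homeomorphUniversalCover hY).isLocalHomeomorph

theorem isSeparatedMap_proj : IsSeparatedMap (proj : UniversalCover y₀ → Y) :=
  (SheetCover.isSeparatedMap_proj hY).comp_right
    (SheetCover.homeomorphUniversalCover hY).continuous
    (SheetCover.homeomorphUniversalCover hY).injective

/-- Local continuous sections of `ofPath`. They replace the quotient property where a product of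
universal coverings is the source, since products of quotient maps need not be quotient maps. -/
theorem exists_local_path (w : UniversalCover y₀) :
    ∃ U : Set (UniversalCover y₀), IsOpen U ∧ w ∈ U ∧
      ∃ s : C(U, BasedPath y₀), ∀ u, ofPath (s u) = u.1 := by
  obtain ⟨y, a⟩ := w
  obtain ⟨N⟩ := hY.nonempty_contractingNhd y
  obtain ⟨s, hs⟩ := SheetCover.exists_path_sheet N ((N.cls ⟨y, N.mem⟩).symm.trans a)
  let e := SheetCover.homeomorphUniversalCover (y₀ := y₀) hY
  let U : Set (UniversalCover y₀) :=
    e ⁻¹' Set.range (SheetCover.sheet N ((N.cls ⟨y, N.mem⟩).symm.trans a))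
  have hU : ∀ u : U, proj u.1 ∈ N.carrier := by
    rintro ⟨u, v, hv⟩
    have : proj u = v.1 := (congrArg SheetCover.proj hv).symm
    rw [this]
    exact v.2
  refine ⟨U, (SheetCover.isOpenMap_sheet N _).isOpen_range.preimage e.continuous,
    ⟨⟨y, N.mem⟩, SheetCover.sheet_eq_self N a⟩,
    s.comp ⟨fun u => ⟨proj u.1, hU u⟩,
      (continuous_proj.comp continuous_subtype_val).subtype_mk _⟩, fun u => ?_⟩
  obtain ⟨v, hv⟩ := u.2
  have h : (⟨proj u.1, hU u⟩ : N.carrier) = v :=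
    Subtype.ext (congrArg SheetCover.proj hv).symm
  exact ((congrArg (fun v => ofPath (s v)) h).trans (hs v)).trans hv

end UniversalCover

end UniversalCoverTopology

/-! ### The diagonal covering as a separated local homeomorphism -/

section DiagonalCoverTopology

variable {X : Type*} [TopologicalSpace X] {x₀ : X}

namespace SheetCover

/-- Concatenation with a class of loops. -/
noncomputable def smulRight (g : Path.Homotopic.Quotient x₀ x₀) (w : SheetCover x₀) : SheetCover x₀ :=
  ⟨w.1, w.2.trans g⟩

theorem continuous_smulRight (g : Path.Homotopic.Quotient x₀ x₀) :
    Continuous (smulRight g : SheetCover x₀ → _) := by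
  refine ⟨fun U hU => isOpen_iff.2 fun z N h => ?_⟩
  have h1 := isOpen_iff.1 hU z N (h.trans g)
  convert h1 using 1
  ext y
  have h2 : smulRight g (sheet N h y) = sheet N (h.trans g) y :=
    mk_eq_mk.2 (Path.Homotopic.Quotient.trans_assoc (N.cls y) h g)
  rw [Set.mem_preimage, Set.mem_preimage, Set.mem_preimage, h2]

end SheetCover

theorem UniversalCover.continuousConstSMul [LocallyPathConnectedSpace X]
    (hX : LocallyContractsInside X) :
    ContinuousConstSMul (FundamentalGroup X x₀) (UniversalCover x₀) where
  continuous_const_smul g :=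
    (SheetCover.homeomorphUniversalCover hX).symm.continuous.comp
      ((SheetCover.continuous_smulRight g.toPath).comp
        (SheetCover.homeomorphUniversalCover hX).continuous)

namespace DiagonalCover

variable {m : ℕ}

/-- The orbit of a tuple. -/
noncomputable def mk (z : Fin m → UniversalCover x₀) : DiagonalCover m x₀ := Quotient.mk _ z

theorem mk_eq_mk {z w : Fin m → UniversalCover x₀} :
    mk z = mk w ↔ ∃ g : FundamentalGroup X x₀, ∀ i, g • w i = z i := by
  refine Quotient.eq.trans ⟨fun ⟨g, hg⟩ => ⟨g, fun i => congrFun hg i⟩,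
    fun ⟨g, hg⟩ => ⟨g, funext hg⟩⟩

theorem mk_surjective : Function.Surjective (mk : (Fin m → UniversalCover x₀) → _) :=
  Quotient.mk_surjective

variable [LocallyPathConnectedSpace X] (hX : LocallyContractsInside X)

include hX

theorem isOpenQuotientMap_mk :
    IsOpenQuotientMap (mk : (Fin m → UniversalCover x₀) → DiagonalCover m x₀) := by
  have := UniversalCover.continuousConstSMul (x₀ := x₀) hX
  exact MulAction.isOpenQuotientMap_quotientMk

theorem isOpenMap_proj : IsOpenMap (proj : DiagonalCover m x₀ → (Fin m → X)) := by
  have h : IsOpenMap (Pi.map fun _ => UniversalCover.proj :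
      (Fin m → UniversalCover x₀) → (Fin m → X)) :=
    .piMap (fun _ => (UniversalCover.isLocalHomeomorph_proj hX).isOpenMap)
      (by simp)
  intro U hU
  have h1 := h _ (hU.preimage (isOpenQuotientMap_mk hX).continuous)
  convert h1 using 1
  ext y
  constructor
  · rintro ⟨a, ha, rfl⟩
    obtain ⟨z, rfl⟩ := mk_surjective a
    exact ⟨z, ha, rfl⟩
  · rintro ⟨z, hz, rfl⟩
    exact ⟨mk z, hz, rfl⟩

/-- The open set of the tuples in a product of sheets. -/
def sheets {y : Fin m → X} (N : ∀ i, ContractingNhd (y i))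
    (g : ∀ i, Path.Homotopic.Quotient (y i) x₀) : Set (Fin m → UniversalCover x₀) :=
  {w | ∀ i, SheetCover.homeomorphUniversalCover hX (w i) ∈
    Set.range (SheetCover.sheet (N i) (g i))}

theorem isOpen_image_sheets {y : Fin m → X} (N : ∀ i, ContractingNhd (y i))
    (g : ∀ i, Path.Homotopic.Quotient (y i) x₀) : IsOpen (mk '' sheets hX N g) := by
  refine (isOpenQuotientMap_mk hX).isOpenMap _ ?_
  have : sheets hX N g = ⋂ i, (fun w : Fin m → UniversalCover x₀ =>
      SheetCover.homeomorphUniversalCover hX (w i)) ⁻¹'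
        Set.range (SheetCover.sheet (N i) (g i)) := by
    ext w
    simp [sheets]
  rw [this]
  exact isOpen_iInter_of_finite fun i =>
    (SheetCover.isOpenMap_sheet (N i) (g i)).isOpen_range.preimage (by fun_prop)

theorem mem_sheets {z : Fin m → UniversalCover x₀} (N : ∀ i, ContractingNhd (z i).1) :
    z ∈ sheets hX N fun i => ((N i).cls ⟨(z i).1, (N i).mem⟩).symm.trans (z i).2 :=
  fun i => ⟨⟨(z i).1, (N i).mem⟩, SheetCover.sheet_eq_self (N i) (z i).2⟩

/-- In a product of sheets a tuple is determined by its projection even before orbits are taken. -/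
theorem isLocallyInjective_proj :
    IsLocallyInjective (proj : DiagonalCover m x₀ → (Fin m → X)) := by
  intro a
  obtain ⟨z, rfl⟩ := mk_surjective a
  obtain ⟨N⟩ : Nonempty (∀ i, ContractingNhd (z i).1) :=
    ⟨fun i => (hX.nonempty_contractingNhd _).some⟩
  have hz := mem_sheets hX N
  refine ⟨_, isOpen_image_sheets hX N _, ⟨z, hz, rfl⟩, ?_⟩
  rintro _ ⟨u, hu, rfl⟩ _ ⟨v, hv, rfl⟩ h
  congr 1
  funext i
  obtain ⟨r, hr⟩ := hu i
  obtain ⟨t, ht⟩ := hv i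
  have h1 : r = t := Subtype.ext
    ((congrArg SheetCover.proj hr).trans ((congrFun h i).trans (congrArg SheetCover.proj ht).symm))
  subst h1
  exact hr.symm.trans ht

theorem isLocalHomeomorph_proj :
    IsLocalHomeomorph (proj : DiagonalCover m x₀ → (Fin m → X)) :=
  isLocalHomeomorph_of_isOpenMap_of_isLocallyInjective continuous_proj (isOpenMap_proj hX)
    (isLocallyInjective_proj hX)

/-- If the images of two products of sheets over the same bases meet, one group element relates the
tuples at the meeting point. Cancelling the sheet classes shows that it relates the original tuples
too, so their orbits coincide. -/
theorem isSeparatedMap_proj :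
    IsSeparatedMap (proj : DiagonalCover m x₀ → (Fin m → X)) := by
  intro a b hab hne
  obtain ⟨z, rfl⟩ := mk_surjective a
  obtain ⟨w, rfl⟩ := mk_surjective b
  obtain ⟨y, g, rfl⟩ : ∃ (y : Fin m → X) (g : ∀ i, Path.Homotopic.Quotient (y i) x₀),
    z = fun i => ⟨y i, g i⟩ := ⟨fun i => (z i).1, fun i => (z i).2, rfl⟩
  obtain ⟨g', rfl⟩ : ∃ (g' : ∀ i, Path.Homotopic.Quotient (y i) x₀),
    w = fun i => ⟨y i, g' i⟩ := by
    obtain ⟨y', g', rfl⟩ : ∃ (y : Fin m → X) (g : ∀ i, Path.Homotopic.Quotient (y i) x₀),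
      w = fun i => ⟨y i, g i⟩ := ⟨fun i => (w i).1, fun i => (w i).2, rfl⟩
    obtain rfl : y = y' := hab
    exact ⟨g', rfl⟩
  obtain ⟨N⟩ : Nonempty (∀ i, ContractingNhd (y i)) :=
    ⟨fun i => (hX.nonempty_contractingNhd _).some⟩
  have hz := mem_sheets hX (z := fun i => ⟨y i, g i⟩) N
  have hw := mem_sheets hX (z := fun i => ⟨y i, g' i⟩) N
  refine ⟨_, _, isOpen_image_sheets hX N _, isOpen_image_sheets hX N _, ⟨_, hz, rfl⟩,
    ⟨_, hw, rfl⟩, ?_⟩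
  rw [Set.disjoint_left]
  rintro _ ⟨u, hu, rfl⟩ ⟨v, hv, huv⟩
  obtain ⟨k, hk⟩ := mk_eq_mk.1 huv.symm
  refine hne (mk_eq_mk.2 ⟨k, fun i => SheetCover.mk_eq_mk.2 ?_⟩)
  obtain ⟨r, hr⟩ := hu i
  obtain ⟨t, ht⟩ := hv i
  have h1 : t = r := Subtype.ext ((congrArg SheetCover.proj ht).trans
    ((congrArg UniversalCover.proj (hk i)).trans (congrArg SheetCover.proj hr).symm))
  subst h1
  have h2 : (((N i).cls t).trans (((N i).cls ⟨y i, (N i).mem⟩).symm.trans (g' i))).trans k.toPath =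
      ((N i).cls t).trans (((N i).cls ⟨y i, (N i).mem⟩).symm.trans (g i)) :=
    SheetCover.mk_eq_mk.1 ((congrArg (SheetCover.smulRight k.toPath) ht).trans
      ((hk i).trans hr.symm))
  rw [Path.Homotopic.Quotient.trans_assoc, Path.Homotopic.Quotient.trans_assoc] at h2
  exact SheetCover.trans_left_cancel _ (SheetCover.trans_left_cancel _ h2)

end DiagonalCover

end DiagonalCoverTopology

/-! ### Complete regularity of covering spaces and interpolation at finitely many points -/

section CompletelyRegular

theorem IsSeparatedMap.t2Space {E B : Type*} [TopologicalSpace E] [TopologicalSpace B] [T2Space B]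
    {p : E → B} (hs : IsSeparatedMap p) (hc : Continuous p) : T2Space E := by
  refine ⟨fun z w h => ?_⟩
  by_cases hp : p z = p w
  · exact hs z w hp h
  · obtain ⟨u, v, hu, hv, hzu, hwv, hd⟩ := t2_separation hp
    exact ⟨_, _, hu.preimage hc, hv.preimage hc, hzu, hwv, hd.preimage p⟩

/-- A separating function on the base is lifted to one injective open set and extended by 1.
Separatedness gives continuity at points outside that set which lie over its image. -/
theorem IsSeparatedMap.completelyRegularSpace {E B : Type*} [TopologicalSpace E]
    [TopologicalSpace B] [CompletelyRegularSpace B] {p : E → B} (hs : IsSeparatedMap p)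
    (hp : IsLocalHomeomorph p) : CompletelyRegularSpace E := by
  refine ⟨fun z K hK hz => ?_⟩
  obtain ⟨O₁, hO₁, hz₁, hi₁⟩ := hp.isLocallyInjective z
  let O := O₁ ∩ Kᶜ
  have hO : IsOpen O := hO₁.inter hK.isOpen_compl
  have hi : Set.InjOn p O := hi₁.mono Set.inter_subset_left
  obtain ⟨f, hf, hf0, hf1⟩ := CompletelyRegularSpace.completely_regular (p z) (p '' O)ᶜ
    (hp.isOpenMap _ hO).isClosed_compl (fun h => h ⟨z, ⟨hz₁, hz⟩, rfl⟩)
  classical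
  refine ⟨fun w => if w ∈ O then f (p w) else 1, ?_, ?_, ?_⟩
  · refine continuous_iff_continuousAt.2 fun w => ?_
    by_cases hw : w ∈ O
    · refine (hf.comp hp.continuous).continuousAt.congr ?_
      filter_upwards [hO.mem_nhds hw] with v hv
      simp [hv]
    · by_cases hpw : p w ∈ p '' O
      · obtain ⟨w', hw', hpw'⟩ := hpw
        obtain ⟨s, t, hs', ht, hws, hwt, hd⟩ := hs w w' hpw'.symm fun h => hw (h ▸ hw')
        refine continuousAt_const.congr (f := fun _ => 1) ?_
        have hopen := (hp.isOpenMap _ (hO.inter ht)).preimage hp.continuous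
        filter_upwards [hs'.mem_nhds hws, hopen.mem_nhds ⟨w', ⟨hw', hwt⟩, hpw'⟩] with v hvs hv
        obtain ⟨v', hv', hpv⟩ := hv
        -- If `v` were in `O`, injectivity would identify it with `v'`, which lies in `t`, whereas
        -- `v` lies in the disjoint set `s`.
        have hvO : v ∉ O := fun h => by
          rw [hi hv'.1 h hpv] at hv'
          exact Set.disjoint_left.1 hd hvs hv'.2
        simp [hvO]
      · have h1 : f (p w) = 1 := hf1 hpw
        have h2 : Filter.Tendsto (fun v => f (p v)) (𝓝 w) (𝓝 1) :=
          h1 ▸ (hf.comp hp.continuous).continuousAt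
        rw [ContinuousAt, if_neg hw]
        exact h2.if' tendsto_const_nhds
  · simp [O, hz₁, hz, hf0]
  · intro w hw
    simp [O, hw]

variable {E : Type*} [TopologicalSpace E] [CompletelyRegularSpace E]

theorem exists_continuous_eq_zero_eq_one (T : Finset E) {W : Set E} (hW : IsOpen W)
    (hT : ∀ x ∈ T, x ∈ W) : ∃ θ : BoundedContinuousFunction E ℝ, (∀ x, 0 ≤ θ x) ∧
      (∀ x ∈ T, θ x = 0) ∧ ∀ x ∉ W, θ x = 1 := by
  have h : ∀ y : E, ∃ f : E → I, Continuous f ∧ (y ∈ W → f y = 0) ∧ ∀ x ∉ W, f x = 1 := by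
    intro y
    by_cases hy : y ∈ W
    · obtain ⟨f, hf, h0, h1⟩ := CompletelyRegularSpace.completely_regular y Wᶜ
        hW.isClosed_compl (fun h => h hy)
      exact ⟨f, hf, fun _ => h0, fun x hx => h1 hx⟩
    · exact ⟨fun _ => 1, continuous_const, fun h => (hy h).elim, fun _ _ => rfl⟩
  choose f hf h0 h1 using h
  refine ⟨.ofNormedAddCommGroup (fun x => ∏ y ∈ T, (f y x : ℝ)) (by fun_prop) 1 fun x => ?_,
    fun x => ?_, fun x hx => ?_, fun x hx => ?_⟩
  · rw [norm_prod]
    refine Finset.prod_le_one (fun _ _ => norm_nonneg _) fun y _ => ?_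
    rw [Real.norm_eq_abs, abs_of_nonneg (f y x).2.1]
    exact (f y x).2.2
  · exact Finset.prod_nonneg fun y _ => (f y x).2.1
  · exact Finset.prod_eq_zero hx (by simp [h0 x (hT x hx)])
  · exact Finset.prod_eq_one fun y _ => by simp [h1 y x hx]

/-- Lagrange interpolation: `θ y` is 1 at `y` and 0 at the other points of `T`. -/
theorem exists_boundedContinuousFunction_eq [T1Space E] (T : Finset E) (v : E → ℝ) :
    ∃ ψ : BoundedContinuousFunction E ℝ, ∀ x ∈ T, ψ x = v x := by
  classical
  have h : ∀ y : E, ∃ θ : BoundedContinuousFunction E ℝ, (∀ x ∈ T.erase y, θ x = 0) ∧ θ y = 1 := by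
    intro y
    obtain ⟨θ, -, h0, h1⟩ := exists_continuous_eq_zero_eq_one (T.erase y)
      (isClosed_singleton (x := y)).isOpen_compl (fun x hx => (Finset.mem_erase.1 hx).1)
    exact ⟨θ, h0, h1 y (by simp)⟩
  choose θ h0 h1 using h
  refine ⟨∑ y ∈ T, v y • θ y, fun x hx => ?_⟩
  rw [BoundedContinuousFunction.coe_sum, Finset.sum_apply, Finset.sum_eq_single x]
  · simp [h1]
  · intro y _ hyx
    simp [h0 y x (Finset.mem_erase.2 ⟨hyx.symm, hx⟩)]
  · exact fun h => (h hx).elim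

end CompletelyRegular

/-! ### Lifting weakly continuous families of measures through pullbacks -/

section Transfer

theorem integral_sum_smul_dirac {E : Type*} [TopologicalSpace E] [MeasurableSpace E] [BorelSpace E]
    {n : ℕ} {c : Fin n → ℝ≥0∞} (hc : ∑ i, c i = 1) (z : Fin n → E)
    (φ : BoundedContinuousFunction E ℝ) :
    ∫ x, φ x ∂(∑ i, c i • Measure.dirac (z i)) = ∑ i, (c i).toReal * φ (z i) := by
  have hfin : ∀ i, c i ≠ ∞ := fun i =>
    ne_top_of_le_ne_top ENNReal.one_ne_top
      (hc ▸ Finset.single_le_sum (f := c) (fun _ _ => zero_le) (Finset.mem_univ i))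
  have hi : ∀ i, Integrable φ (c i • Measure.dirac (z i)) := fun i =>
    (φ.integrable (Measure.dirac (z i))).smul_measure (hfin i)
  rw [integral_finsetSum_measure fun i _ => hi i]
  refine Finset.sum_congr rfl fun i _ => ?_
  rw [integral_smul_measure, integral_dirac' _ _ φ.continuous.stronglyMeasurable, smul_eq_mul]

variable {E B E' A : Type*} [TopologicalSpace E] [TopologicalSpace E'] [TopologicalSpace A]
  {p : E → B} {p' : E' → A} {f : A → B} {G : E' → E}

/-- If the measures with given weights at given points depend continuously on a parameter, then so
do those at the lifted points. -/
theorem tendsto_sum_lift [T1Space E] [CompletelyRegularSpace E] (hp : IsLocallyInjective p)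
    (hp' : IsOpenMap p') (hG : Continuous G) (hpG : ∀ w, p (G w) = f (p' w))
    (hinj : ∀ w w', p' w = p' w' → G w = G w' → w = w') {n : ℕ}
    (c : A → Fin n → ℝ) (z : A → Fin n → E) (w : A → Fin n → E') (hc : ∀ a, ∑ i, c a i = 1)
    (hc0 : ∀ a i, 0 ≤ c a i) (hw : ∀ a i, c a i ≠ 0 → p' (w a i) = a ∧ G (w a i) = z a i) (a₀ : A)
    (h : ∀ ψ : BoundedContinuousFunction E ℝ, Filter.Tendsto
      (fun a => ∑ i, c a i * ψ (z a i)) (𝓝 a₀) (𝓝 (∑ i, c a₀ i * ψ (z a₀ i))))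
    (φ : BoundedContinuousFunction E' ℝ) : Filter.Tendsto
      (fun a => ∑ i, c a i * φ (w a i)) (𝓝 a₀) (𝓝 (∑ i, c a₀ i * φ (w a₀ i))) := by
  classical
  let S : Finset (Fin n) := Finset.univ.filter fun i => c a₀ i ≠ 0
  have hS : ∀ i ∈ S, p' (w a₀ i) = a₀ ∧ G (w a₀ i) = z a₀ i := fun i hi =>
    hw a₀ i (Finset.mem_filter.1 hi).2
  let T : Finset E := S.image (z a₀)
  obtain ⟨v, hv⟩ : ∃ v : E → ℝ, ∀ i ∈ S, v (z a₀ i) = φ (w a₀ i) := by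
    refine ⟨fun x => if hx : ∃ i ∈ S, z a₀ i = x then φ (w a₀ hx.choose) else 0, fun i hi => ?_⟩
    have hx : ∃ j ∈ S, z a₀ j = z a₀ i := ⟨i, hi, rfl⟩
    refine (dif_pos hx).trans ?_
    have hj := hx.choose_spec
    congr 1
    exact hinj _ _ ((hS _ hj.1).1.trans (hS i hi).1.symm)
      ((hS _ hj.1).2.trans (hj.2.trans (hS i hi).2.symm))
  -- `ψ` on `E` imitates `φ` at the atoms over `a₀`. Near these atoms the two stay `δ`-close, and a
  -- second test function `θ` bounds the mass that lies elsewhere.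
  obtain ⟨ψ, hψ⟩ := exists_boundedContinuousFunction_eq T v
  have hψ' : ∀ i ∈ S, ψ (z a₀ i) = φ (w a₀ i) := fun i hi =>
    (hψ _ (Finset.mem_image_of_mem _ hi)).trans (hv i hi)
  have hsum : ∑ i, c a₀ i * ψ (z a₀ i) = ∑ i, c a₀ i * φ (w a₀ i) := by
    refine Finset.sum_congr rfl fun i _ => ?_
    by_cases h0 : c a₀ i = 0
    · simp [h0]
    · rw [hψ' i (by simp [S, h0])]
  let C := ‖φ‖ + ‖ψ‖
  have hC : 0 ≤ C := by positivity
  rw [Metric.tendsto_nhds]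
  intro ε hε
  -- The total error is at most `δ` near the atoms, `C * δ` away from them and `δ` from the
  -- convergence for `ψ`.
  let δ := ε / (C + 3)
  have hδ : 0 < δ := by positivity
  have hloc : ∀ i ∈ S, ∃ W : Set E, IsOpen W ∧ z a₀ i ∈ W ∧ ∀ᶠ a in 𝓝 a₀, ∀ w', p' w' = a →
      G w' ∈ W → |φ w' - ψ (G w')| < δ := by
    intro i hi
    obtain ⟨W, hW, hzW, hWi⟩ := hp (z a₀ i)
    refine ⟨W, hW, hzW, ?_⟩
    let Q : Set E' := {w' | |φ w' - ψ (G w')| < δ} ∩ G ⁻¹' W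
    have hQ : IsOpen Q := (isOpen_lt (by fun_prop) continuous_const).inter (hW.preimage hG)
    have hwQ : w a₀ i ∈ Q := by
      refine ⟨?_, ?_⟩
      · simp only [Set.mem_ofPred_eq, (hS i hi).2, hψ' i hi, sub_self, abs_zero]
        exact hδ
      · rw [Set.mem_preimage, (hS i hi).2]
        exact hzW
    filter_upwards [(hp' Q hQ).mem_nhds ⟨_, hwQ, (hS i hi).1⟩]
    rintro a ⟨w₁, hw₁, hwa⟩ w' hw' hGw'
    -- Openness of `p'` supplies a good point `w₁` over `a`; injectivity of `p` on `W` forces `w'`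
    -- to be that point.
    have h1 : G w' = G w₁ := hWi hGw' hw₁.2 (by rw [hpG, hpG, hw', hwa])
    rw [hinj w' w₁ (hw'.trans hwa.symm) h1]
    exact hw₁.1
  choose! W hW hzW hev using hloc
  obtain ⟨θ, hθ0, hθT, hθ1⟩ := exists_continuous_eq_zero_eq_one T
    (W := ⋃ i ∈ S, W i) (isOpen_biUnion fun i hi => hW i hi) (by
      intro x hx
      obtain ⟨i, hi, rfl⟩ := Finset.mem_image.1 hx
      exact Set.mem_biUnion hi (hzW i hi))
  have hθsum : ∑ i, c a₀ i * θ (z a₀ i) = 0 := by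
    refine Finset.sum_eq_zero fun i _ => ?_
    by_cases h0 : c a₀ i = 0
    · simp [h0]
    · rw [hθT _ (Finset.mem_image_of_mem _ (by simp [S, h0])), mul_zero]
  have e1 := Metric.tendsto_nhds.1 (h ψ) δ hδ
  have e2 := Metric.tendsto_nhds.1 (h θ) δ hδ
  rw [hsum] at e1
  rw [hθsum] at e2
  filter_upwards [e1, e2, (Filter.eventually_all_finset S).2 hev] with a h1 h2 h3
  rw [Real.dist_eq] at h1 h2 ⊢
  have hterm : ∀ i, |c a i * φ (w a i) - c a i * ψ (z a i)| ≤
      c a i * δ + C * (c a i * θ (z a i)) := by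
    intro i
    by_cases h0 : c a i = 0
    · simp [h0]
    · rw [← mul_sub, abs_mul, abs_of_nonneg (hc0 a i)]
      have hbound : |φ (w a i) - ψ (z a i)| ≤ δ + C * θ (z a i) := by
        by_cases hz : z a i ∈ ⋃ i ∈ S, W i
        · obtain ⟨j, hj, hzj⟩ := Set.mem_iUnion₂.1 hz
          have := h3 j hj (w a i) (hw a i h0).1 ((hw a i h0).2 ▸ hzj)
          rw [(hw a i h0).2] at this
          have := mul_nonneg hC (hθ0 (z a i))
          linarith
        · rw [hθ1 _ hz, mul_one]
          have b1 := φ.norm_coe_le_norm (w a i)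
          have b2 := ψ.norm_coe_le_norm (z a i)
          rw [Real.norm_eq_abs] at b1 b2
          have := abs_sub (φ (w a i)) (ψ (z a i))
          simp only [C]
          linarith
      calc c a i * |φ (w a i) - ψ (z a i)| ≤ c a i * (δ + C * θ (z a i)) :=
            mul_le_mul_of_nonneg_left hbound (hc0 a i)
        _ = _ := by ring
  have hdiff : |∑ i, c a i * φ (w a i) - ∑ i, c a i * ψ (z a i)| ≤
      δ + C * ∑ i, c a i * θ (z a i) := by
    rw [← Finset.sum_sub_distrib]
    refine (Finset.abs_sum_le_sum_abs _ _).trans ((Finset.sum_le_sum fun i _ => hterm i).trans ?_)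
    rw [Finset.sum_add_distrib, ← Finset.sum_mul, hc a, one_mul, ← Finset.mul_sum]
  have h2' : ∑ i, c a i * θ (z a i) ≤ δ := by
    have := le_abs_self (∑ i, c a i * θ (z a i) - 0)
    linarith
  have h4 : C * ∑ i, c a i * θ (z a i) ≤ C * δ := mul_le_mul_of_nonneg_left h2' hC
  have h5 := abs_sub_le (∑ i, c a i * φ (w a i)) (∑ i, c a i * ψ (z a i))
    (∑ i, c a₀ i * φ (w a₀ i))
  have h6 : (C + 3) * δ = ε := by
    simp only [δ]
    field_simp
  nlinarith

variable [TopologicalSpace B] [MeasurableSpace E] [BorelSpace E] [MeasurableSpace E']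
  [BorelSpace E']

/-- The distributional sectional category does not increase under pullback. -/
theorem dsecat_le_of_pullback [T1Space E] [CompletelyRegularSpace E] [T1Space A] [T1Space B]
    (hpc : Continuous p) (hp : IsLocallyInjective p) (hpc' : Continuous p')
    (hp' : IsOpenMap p') (hf : Continuous f) (hG : Continuous G)
    (hpG : ∀ w, p (G w) = f (p' w)) (hb : ∀ a z, p z = f a → ∃! w, p' w = a ∧ G w = z) :
    dsecat p' ≤ dsecat p := by
  refine le_iInf₂ fun k ⟨s, hs⟩ => iInf₂_le k ?_
  have hinj : ∀ w w', p' w = p' w' → G w = G w' → w = w' := fun w w' h1 h2 =>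
    (hb (p' w') (G w') (hpG w')).unique ⟨h1, h2⟩ ⟨rfl, rfl⟩
  have hex : ∀ a, ∃ (c : Fin (k + 1) → ℝ≥0∞) (z : Fin (k + 1) → E) (w : Fin (k + 1) → E'),
      ∑ i, c i = 1 ∧ ((s (f a)).1 : Measure E) = ∑ i, c i • Measure.dirac (z i) ∧
      ∀ i, c i ≠ 0 → p' (w i) = a ∧ G (w i) = z i := by
    intro a
    obtain ⟨z, c, hc, hm, hz⟩ := (fibrewiseProj_eq_iff hpc _ _).1 (hs (f a))
    obtain ⟨i, hi⟩ : ∃ i, c i ≠ 0 := by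
      by_contra! h
      simp [h] at hc
    -- Atoms of weight zero need not lie over `f a`; their lifts are arbitrary points.
    have : Nonempty E' := ⟨(hb a (z i) (hz i hi)).choose⟩
    have h1 : ∀ i, ∃ w, c i ≠ 0 → p' w = a ∧ G w = z i := fun i => by
      by_cases h0 : c i = 0
      · exact ⟨Classical.arbitrary E', fun h => (h h0).elim⟩
      · exact ⟨_, fun _ => (hb a (z i) (hz i h0)).choose_spec.1⟩
    choose w hw using h1
    exact ⟨c, z, w, hc, hm, hw⟩
  -- The chosen weights and atoms need not be continuous in `a`; only the measure they represent is.
  choose c z w hc hm hw using hex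
  have hprob : ∀ a, IsProbabilityMeasure (∑ i, c a i • Measure.dirac (w a i)) := fun a => by
    refine ⟨?_⟩
    rw [Measure.finsetSum_apply, ← hc a]
    exact Finset.sum_congr rfl fun i _ => by simp
  let ν : A → ProbabilityMeasure E' := fun a => ⟨_, hprob a⟩
  have hν : ∀ a, ν a ∈ finitelySupportedMeasures (k + 1) (p' ⁻¹' {a}) := fun a =>
    ⟨w a, c a, hc a, rfl, fun i hi => (hw a i hi).1⟩
  have hfin : ∀ a i, c a i ≠ ∞ := fun a i =>
    ne_top_of_le_ne_top ENNReal.one_ne_top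
      (hc a ▸ Finset.single_le_sum (f := c a) (fun _ _ => zero_le) (Finset.mem_univ i))
  have hcont : Continuous ν := by
    refine continuous_iff_continuousAt.2 fun a₀ => ?_
    rw [ContinuousAt, ProbabilityMeasure.tendsto_iff_forall_integral_tendsto]
    intro φ
    simp only [ν, ProbabilityMeasure.coe_mk, integral_sum_smul_dirac (hc _)]
    refine tendsto_sum_lift hp hp' hG hpG hinj (fun a i => (c a i).toReal) z w (fun a => ?_)
      (fun a i => ENNReal.toReal_nonneg)
      (fun a i h => hw a i fun h0 => h (by simp [h0])) a₀ (fun ψ => ?_) φ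
    · rw [← ENNReal.toReal_sum fun i _ => hfin a i, hc a, ENNReal.toReal_one]
    · have h1 : Continuous fun a => (s (f a)).1 :=
        continuous_subtype_val.comp (s.continuous.comp hf)
      have h2 := (ProbabilityMeasure.tendsto_iff_forall_integral_tendsto.1
        (h1.tendsto a₀)) ψ
      simpa only [hm, integral_sum_smul_dirac (hc _)] using h2
  refine ⟨⟨fun a => ⟨ν a, a, hν a⟩, hcont.subtype_mk _⟩, fun a => ?_⟩
  exact (fibrewiseProj_eq_iff hpc' _ _).2 (hν a)

end Transfer

/-! ### Homotopies and products acting on path classes -/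

section QuotientPaths

variable {X Y : Type*} [TopologicalSpace X] [TopologicalSpace Y]

theorem Path.Homotopic.Quotient.trans_right_cancel {x y z : X}
    {a b : Path.Homotopic.Quotient x y} (c : Path.Homotopic.Quotient y z)
    (h : a.trans c = b.trans c) : a = b := by
  have := congrArg (·.trans c.symm) h
  simpa [Path.Homotopic.Quotient.trans_assoc] using this

theorem Path.Homotopic.Quotient.trans_trans_symm {x y z : X} (a : Path.Homotopic.Quotient x y)
    (b : Path.Homotopic.Quotient y z) : (a.trans b).trans b.symm = a := by
  rw [trans_assoc, trans_symm, trans_refl]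

theorem Path.Homotopic.Quotient.trans_symm_trans {x y z : X} (a : Path.Homotopic.Quotient x y)
    (b : Path.Homotopic.Quotient z y) : (a.trans b.symm).trans b = a := by
  rw [trans_assoc, symm_trans, trans_refl]

theorem ContinuousMap.Homotopy.map_trans_evalAt {f g : C(X, Y)} (F : f.Homotopy g) {x x' : X}
    (p : Path.Homotopic.Quotient x x') :
    (p.map f).trans (.mk (F.evalAt x')) =
      (Path.Homotopic.Quotient.mk (F.evalAt x)).trans (p.map g) := by
  induction p using Path.Homotopic.Quotient.ind with | mk p =>
  exact Path.Homotopic.Quotient.eq.2 (Path.Homotopic.map_trans_evalAt F p)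

theorem Path.Homotopic.Quotient.map_const {x x' : X} (p : Path.Homotopic.Quotient x x') (y : Y) :
    p.map (ContinuousMap.const X y) = .refl y := by
  induction p using Path.Homotopic.Quotient.ind with | mk p =>
  rfl

theorem Path.Homotopic.Quotient.map_id' {x x' : X} (p : Path.Homotopic.Quotient x x') :
    p.map (ContinuousMap.id X) = p := by
  induction p using Path.Homotopic.Quotient.ind with | mk p =>
  rfl

/-- A null-homotopic map sends loops to trivial classes. -/
theorem ContinuousMap.Homotopy.map_loop_eq_refl {f : C(X, Y)} {y : Y}
    (F : f.Homotopy (ContinuousMap.const X y)) {x : X} (p : Path.Homotopic.Quotient x x) :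
    p.map f = .refl (f x) := by
  refine Path.Homotopic.Quotient.trans_right_cancel (.mk (F.evalAt x)) ?_
  rw [F.map_trans_evalAt p, Path.Homotopic.Quotient.map_const, Path.Homotopic.Quotient.refl_trans]
  exact Path.Homotopic.Quotient.trans_refl _

/-- A map that is homotopic to the identity is bijective on classes of paths. -/
theorem ContinuousMap.Homotopy.bijective_map {f : C(X, X)} (F : f.Homotopy (ContinuousMap.id X))
    (x x' : X) : Function.Bijective fun p : Path.Homotopic.Quotient x x' => p.map f := by
  have h := fun p : Path.Homotopic.Quotient x x' => F.map_trans_evalAt p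
  simp only [Path.Homotopic.Quotient.map_id'] at h
  let a : Path.Homotopic.Quotient (f x) x := .mk (F.evalAt x)
  let b : Path.Homotopic.Quotient (f x') x' := .mk (F.evalAt x')
  replace h : ∀ p : Path.Homotopic.Quotient x x', (p.map f).trans b = a.trans p := h
  refine ⟨fun p q (hpq : p.map f = q.map f) => ?_, fun q => ⟨a.symm.trans (q.trans b), ?_⟩⟩
  · exact SheetCover.trans_left_cancel a (by rw [← h, ← h, hpq])
  · refine Path.Homotopic.Quotient.trans_right_cancel b ((h _).trans ?_)
    rw [← Path.Homotopic.Quotient.trans_assoc, Path.Homotopic.Quotient.trans_symm,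
      Path.Homotopic.Quotient.refl_trans]

/-- A path in a product is homotopic to moving the first coordinate and then the second. -/
theorem Path.Homotopic.Quotient.map_prod {Z : Type*} [TopologicalSpace Z] (m : C(X × Y, Z))
    {x x' : X} {y y' : Y} (p : Path.Homotopic.Quotient x x') (q : Path.Homotopic.Quotient y y') :
    (Path.Homotopic.prod p q).map m =
      (p.map (m.comp ((ContinuousMap.id X).prodMk (ContinuousMap.const X y)))).trans
        (q.map (m.comp ((ContinuousMap.const Y x').prodMk (ContinuousMap.id Y)))) := by
  have h : Path.Homotopic.prod p q =
      (Path.Homotopic.prod p (.refl y)).trans (Path.Homotopic.prod (.refl x') q) := by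
    have := Path.Homotopic.comp_prod_eq_prod_comp p (.refl y) (.refl x') q
    rw [this, Path.Homotopic.Quotient.trans_refl, Path.Homotopic.Quotient.refl_trans]
  rw [h, SheetCover.map_trans]
  induction p using Path.Homotopic.Quotient.ind with | mk p =>
  induction q using Path.Homotopic.Quotient.ind with | mk q =>
  rfl

end QuotientPaths

/-! ### Induced maps and products of universal coverings -/

namespace UniversalCover

variable {X Y Z : Type*} [TopologicalSpace X] [TopologicalSpace Y] [TopologicalSpace Z]
  {x₀ : X} {y₀ : Y} {z₀ : Z}

/-- The map of universal covering spaces that a map and a change of base points induce. -/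
noncomputable def map (f : C(X, Y)) (c : Path.Homotopic.Quotient (f x₀) y₀)
    (w : UniversalCover x₀) : UniversalCover y₀ :=
  ⟨f w.1, (w.2.map f).trans c⟩

theorem mk_eq_mk {y : Y} {a b : Path.Homotopic.Quotient y y₀} :
    (⟨y, a⟩ : UniversalCover y₀) = ⟨y, b⟩ ↔ a = b :=
  SheetCover.mk_eq_mk

theorem continuous_map (f : C(X, Y)) (c : Path.Homotopic.Quotient (f x₀) y₀) :
    Continuous (map f c : UniversalCover x₀ → UniversalCover y₀) := by
  obtain ⟨c, rfl⟩ := Path.Homotopic.Quotient.mk_surjective c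
  refine continuous_coinduced_dom.2 ?_
  have hv : Continuous fun γ : BasedPath x₀ => γ.1 := continuous_subtype_val
  let α : ∀ γ : BasedPath x₀, Path (f (γ.1 0)) (f x₀) := fun γ =>
    ⟨f.comp γ.1, rfl, congrArg f γ.2⟩
  have hα : Continuous ↿α := by
    change Continuous fun q : BasedPath x₀ × I => f (q.1.1 q.2)
    exact f.continuous.comp (Continuous.eval (by fun_prop) (by fun_prop))
  have hc : Continuous ↿(fun _ : BasedPath x₀ => c) := by
    change Continuous fun q : BasedPath x₀ × I => c q.2
    fun_prop
  have ht := Path.trans_continuous_family _ hα _ hc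
  let s : C(BasedPath x₀, C(I, Y)) := ContinuousMap.curry ⟨_, ht⟩
  let s' : BasedPath x₀ → BasedPath y₀ := fun γ => ⟨s γ, Path.target ((α γ).trans c)⟩
  have hs' : Continuous s' := s.continuous.subtype_mk _
  have h1 : Continuous fun γ => UniversalCover.ofPath (s' γ) :=
    (continuous_coinduced_rng : Continuous (UniversalCover.ofPath : BasedPath y₀ → _)).comp hs'
  refine h1.congr fun γ => ?_
  have h0 : s γ 0 = f (γ.1 0) := Path.source ((α γ).trans c)
  refine Sigma.ext h0 ?_
  exact Path.Homotopic.hpath_hext fun t => rfl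

/-- The product of universal covering spaces maps to the universal covering space of the
product. -/
noncomputable def prod (u : UniversalCover x₀) (v : UniversalCover y₀) :
    UniversalCover (x₀, y₀) :=
  ⟨(u.1, v.1), Path.Homotopic.prod u.2 v.2⟩

theorem continuous_prod [LocallyPathConnectedSpace X] [LocallyPathConnectedSpace Y]
    (hX : LocallyContractsInside X) (hY : LocallyContractsInside Y) :
    Continuous fun w : UniversalCover x₀ × UniversalCover y₀ => prod w.1 w.2 := by
  refine continuous_iff_continuousAt.2 fun w => ?_
  obtain ⟨U, hU, hwU, s, hs⟩ := exists_local_path hX w.1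
  obtain ⟨V, hV, hwV, t, ht⟩ := exists_local_path hY w.2
  have hw : (U ×ˢ V : Set (UniversalCover x₀ × UniversalCover y₀)) ∈ 𝓝 w :=
    (hU.prod hV).mem_nhds ⟨hwU, hwV⟩
  refine ContinuousOn.continuousAt (continuousOn_iff_continuous_domRestrict.2 ?_) hw
  have hv : Continuous fun γ : BasedPath x₀ => γ.1 := continuous_subtype_val
  have hv' : Continuous fun γ : BasedPath y₀ => γ.1 := continuous_subtype_val
  let S : (U ×ˢ V : Set (UniversalCover x₀ × UniversalCover y₀)) → BasedPath (x₀, y₀) := fun q =>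
    ⟨(s ⟨q.1.1, q.2.1⟩).1.prodMk (t ⟨q.1.2, q.2.2⟩).1,
      Prod.ext (s ⟨q.1.1, q.2.1⟩).2 (t ⟨q.1.2, q.2.2⟩).2⟩
  have hS : Continuous S := by
    refine Continuous.subtype_mk (ContinuousMap.continuous_of_continuous_uncurry _ ?_) _
    refine Continuous.prodMk ?_ ?_
    · exact Continuous.eval (hv.comp (s.continuous.comp (by fun_prop))) (by fun_prop)
    · exact Continuous.eval (hv'.comp (t.continuous.comp (by fun_prop))) (by fun_prop)
  refine ((continuous_coinduced_rng :
    Continuous (UniversalCover.ofPath : BasedPath (x₀, y₀) → _)).comp hS).congr ?_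
  rintro ⟨⟨u, v⟩, hu, hv⟩
  change ofPath (S ⟨(u, v), hu, hv⟩) = prod u v
  exact congrArg₂ prod (hs ⟨u, hu⟩) (ht ⟨v, hv⟩)

section Pi

variable {ι : Type*} {A : ι → Type*} [∀ i, TopologicalSpace (A i)] {a₀ : ∀ i, A i}

/-- The product of universal covering spaces maps to the universal covering space of the
product. -/
noncomputable def pi (w : ∀ i, UniversalCover (a₀ i)) : UniversalCover a₀ :=
  ⟨fun i => (w i).1, Path.Homotopic.pi fun i => (w i).2⟩

/-- The coordinates of a point of the universal covering space of a product. -/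
noncomputable def coord (i : ι) (w : UniversalCover a₀) : UniversalCover (a₀ i) :=
  ⟨w.1 i, Path.Homotopic.proj i w.2⟩

theorem coord_pi (w : ∀ i, UniversalCover (a₀ i)) (i : ι) : coord i (pi w) = w i :=
  mk_eq_mk.2 (Path.Homotopic.proj_pi i fun i => (w i).2)

theorem pi_coord (w : UniversalCover a₀) : pi (fun i => coord i w) = w :=
  mk_eq_mk.2 (Path.Homotopic.pi_proj w.2)

theorem ext_coord {w w' : UniversalCover a₀} (h : ∀ i, coord i w = coord i w') : w = w' := by
  rw [← pi_coord w, ← pi_coord w', funext h]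

theorem continuous_pi [Finite ι] [∀ i, LocallyPathConnectedSpace (A i)]
    (hA : ∀ i, LocallyContractsInside (A i)) :
    Continuous (pi : (∀ i, UniversalCover (a₀ i)) → UniversalCover a₀) := by
  refine continuous_iff_continuousAt.2 fun w => ?_
  choose U hU hwU s hs using fun i => exists_local_path (hA i) (w i)
  have hw : Set.univ.pi U ∈ 𝓝 w :=
    (isOpen_set_pi Set.finite_univ fun i _ => hU i).mem_nhds fun i _ => hwU i
  refine ContinuousOn.continuousAt (continuousOn_iff_continuous_domRestrict.2 ?_) hw
  have hv : ∀ i, Continuous fun γ : BasedPath (a₀ i) => γ.1 := fun i => continuous_subtype_val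
  let S : Set.univ.pi U → BasedPath a₀ := fun q =>
    ⟨⟨fun t i => (s i ⟨q.1 i, q.2 i trivial⟩).1 t, by fun_prop⟩,
      funext fun i => (s i ⟨q.1 i, q.2 i trivial⟩).2⟩
  have hS : Continuous S := by
    refine Continuous.subtype_mk (ContinuousMap.continuous_of_continuous_uncurry _ ?_) _
    refine _root_.continuous_pi fun i => ?_
    exact Continuous.eval ((hv i).comp ((s i).continuous.comp (Continuous.subtype_mk
      ((continuous_apply i).comp (continuous_subtype_val.comp continuous_fst)) _))) (by fun_prop)
  refine ((continuous_coinduced_rng :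
    Continuous (UniversalCover.ofPath : BasedPath a₀ → _)).comp hS).congr ?_
  rintro ⟨u, hu⟩
  refine ext_coord fun i => ?_
  change coord i (ofPath (S ⟨u, hu⟩)) = coord i (pi u)
  rw [coord_pi]
  exact hs i ⟨u i, hu i trivial⟩

end Pi

end UniversalCover

theorem LocallyContractsInside.pi {ι : Type*} [Finite ι] {A : ι → Type*}
    [∀ i, TopologicalSpace (A i)] (h : ∀ i, LocallyContractsInside (A i)) :
    LocallyContractsInside (∀ i, A i) := by
  intro y
  choose V hV H h0 h1 using fun i => h i (y i)
  refine ⟨Set.univ.pi V, set_pi_mem_nhds Set.finite_univ fun i _ => hV i,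
    ContinuousMap.curry ⟨fun q i => H i (q.1 i) q.2, ?_⟩, fun z => funext fun i => h0 i (z i),
    fun z hz => funext fun i => h1 i (z i) (hz i trivial)⟩
  exact continuous_pi fun i => Continuous.eval (by fun_prop) (by fun_prop)

/-! ### Normalizing the first coordinate of an orbit -/

namespace DiagonalCover

variable {X : Type*} [TopologicalSpace X] {x₀ : X} {k : ℕ}

/-- Every orbit has a representative with a prescribed first coordinate. -/
theorem exists_eq_mk_cons (z : DiagonalCover (k + 1) x₀) (η : UniversalCover x₀)
    (h : proj z 0 = η.1) : ∃ ζ : Fin k → UniversalCover x₀,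
      z = mk (Fin.cons η ζ : Fin (k + 1) → UniversalCover x₀) := by
  obtain ⟨z, rfl⟩ := mk_surjective z
  obtain ⟨x, q⟩ := η
  obtain ⟨p, hp⟩ : ∃ p : Path.Homotopic.Quotient x x₀, z 0 = ⟨x, p⟩ := by
    have h' : (z 0).1 = x := h
    subst h'
    exact ⟨(z 0).2, rfl⟩
  let g : FundamentalGroup X x₀ := FundamentalGroup.fromPath (p.symm.trans q)
  have hg : g • z 0 = ⟨x, q⟩ := by
    rw [hp]
    refine UniversalCover.mk_eq_mk.2 ?_
    change p.trans (p.symm.trans q) = q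
    rw [← Path.Homotopic.Quotient.trans_assoc, Path.Homotopic.Quotient.trans_symm,
      Path.Homotopic.Quotient.refl_trans]
  refine ⟨fun i => g • z i.succ, Eq.symm (mk_eq_mk.2 ⟨g, Fin.cases ?_ fun i => ?_⟩)⟩
  · exact hg
  · rfl

/-- The action is already free on the first coordinate, so fixing that coordinate leaves only the
identity. -/
theorem mk_cons_injective (η : UniversalCover x₀) : Function.Injective
    fun ζ : Fin k → UniversalCover x₀ => mk (Fin.cons η ζ : Fin (k + 1) → UniversalCover x₀) := by
  intro ζ ζ' h
  obtain ⟨g, hg⟩ := mk_eq_mk.1 h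
  have h0 : η.2.trans g.toPath = η.2.trans (.refl x₀) :=
    (UniversalCover.mk_eq_mk.1 (hg 0)).trans (Path.Homotopic.Quotient.trans_refl η.2).symm
  have h1 : g = 1 := SheetCover.trans_left_cancel _ h0
  funext i
  have h2 := hg i.succ
  rw [h1, one_smul] at h2
  exact h2.symm

end DiagonalCover

/-! ### The two coverings as pullbacks of each other -/

section Comparison

variable {X : Type*} [TopologicalSpace X] [T2Space X] [CompletelyRegularSpace X]
  [PathConnectedSpace X] [LocallyPathConnectedSpace X] (hX : LocallyContractsInside X)

include hX

/-- The universal covering of `Xᵏ` is a pullback of the diagonal covering of `Xᵏ⁺¹`. -/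
theorem dcatOne_le_dTCDiag (k : ℕ) (x₀ : X) (y₀ : Fin k → X) :
    dcatOne (Fin k → X) y₀ ≤ dTCDiag (k + 1) X x₀ := by
  have hY : LocallyContractsInside (Fin k → X) := .pi fun _ => hX
  have hs := DiagonalCover.isSeparatedMap_proj (m := k + 1) (x₀ := x₀) hX
  have hl := DiagonalCover.isLocalHomeomorph_proj (m := k + 1) (x₀ := x₀) hX
  have hl' := UniversalCover.isLocalHomeomorph_proj (y₀ := y₀) hY
  have := hs.t2Space hl.continuous
  have := hs.completelyRegularSpace hl
  let c : ∀ i, Path.Homotopic.Quotient (y₀ i) x₀ := fun i =>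
    .mk (PathConnectedSpace.somePath _ _)
  let e : ∀ i, C(Fin k → X, X) := fun i => ⟨fun y => y i, continuous_apply i⟩
  let η : UniversalCover x₀ := ⟨x₀, .refl x₀⟩
  let G : UniversalCover y₀ → DiagonalCover (k + 1) x₀ := fun w =>
    DiagonalCover.mk (Fin.cons η fun i => UniversalCover.map (e i) (c i) w :
      Fin (k + 1) → UniversalCover x₀)
  have hG : Continuous G := (DiagonalCover.isOpenQuotientMap_mk hX).continuous.comp
    (continuous_pi (Fin.cases continuous_const fun i => UniversalCover.continuous_map _ _))
  refine dsecat_le_of_pullback (f := fun y => (Fin.cons x₀ y : Fin (k + 1) → X)) hl.continuous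
    hl.isLocallyInjective hl'.continuous hl'.isOpenMap
    (continuous_pi (Fin.cases continuous_const fun i => continuous_apply i)) hG
    (fun w => funext (Fin.cases rfl fun i => rfl)) fun a z hz => ?_
  obtain ⟨ζ, rfl⟩ := DiagonalCover.exists_eq_mk_cons z η (congrFun hz 0)
  have hζ : ∀ i, (ζ i).1 = a i := fun i => congrFun hz i.succ
  obtain ⟨q, rfl⟩ : ∃ q : ∀ i, Path.Homotopic.Quotient (a i) x₀, ζ = fun i => ⟨a i, q i⟩ := by
    obtain rfl : (fun i => (ζ i).1) = a := funext hζ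
    exact ⟨fun i => (ζ i).2, rfl⟩
  refine ⟨⟨a, Path.Homotopic.pi fun i => (q i).trans (c i).symm⟩, ⟨rfl, ?_⟩, ?_⟩
  · refine congrArg (fun ζ => DiagonalCover.mk (Fin.cons η ζ : Fin (k + 1) → UniversalCover x₀))
      (funext fun i => UniversalCover.mk_eq_mk.2 ?_)
    have h1 := Path.Homotopic.proj_pi i fun i => (q i).trans (c i).symm
    exact (congrArg (·.trans (c i)) h1).trans
      (Path.Homotopic.Quotient.trans_symm_trans (q i) (c i))
  · rintro ⟨y, p⟩ ⟨rfl, hw⟩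
    have h := DiagonalCover.mk_cons_injective η hw
    refine UniversalCover.mk_eq_mk.2 ?_
    rw [← Path.Homotopic.pi_proj p]
    congr 1
    funext i
    have h1 : (Path.Homotopic.proj i p).trans (c i) = q i :=
      UniversalCover.mk_eq_mk.1 (congrFun h i)
    exact (Path.Homotopic.Quotient.trans_trans_symm (Path.Homotopic.proj i p) (c i)).symm.trans
      (congrArg (·.trans (c i).symm) h1)

/-- If there is a map that behaves like the difference map of a group, then the diagonal covering
of `Xᵏ⁺¹` is a pullback of the universal covering of `Xᵏ`. -/
theorem dTCDiag_le_dcatOne (k : ℕ) (x₀ : X) (y₀ : Fin k → X) (d : C(X × X, X)) (e : X)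
    (D : (d.comp ((ContinuousMap.id X).prodMk (ContinuousMap.id X))).Homotopy
      (ContinuousMap.const X e))
    (R : ∀ b : X, Nonempty ((d.comp ((ContinuousMap.id X).prodMk
      (ContinuousMap.const X b))).Homotopy (ContinuousMap.id X))) :
    dTCDiag (k + 1) X x₀ ≤ dcatOne (Fin k → X) y₀ := by
  have hY : LocallyContractsInside (Fin k → X) := .pi fun _ => hX
  have hl := DiagonalCover.isLocalHomeomorph_proj (m := k + 1) (x₀ := x₀) hX
  have hl' := UniversalCover.isLocalHomeomorph_proj (y₀ := y₀) hY
  have hs' := UniversalCover.isSeparatedMap_proj (y₀ := y₀) hY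
  have := hs'.t2Space hl'.continuous
  have := hs'.completelyRegularSpace hl'
  let c : ∀ i, Path.Homotopic.Quotient (d (x₀, x₀)) (y₀ i) := fun i =>
    .mk (PathConnectedSpace.somePath _ _)
  let Φ : ∀ i, UniversalCover x₀ → UniversalCover x₀ → UniversalCover (y₀ i) := fun i u v =>
    UniversalCover.map d (c i) (UniversalCover.prod u v)
  have hΦ : ∀ i (g : FundamentalGroup X x₀) u v, Φ i (g • u) (g • v) = Φ i u v := by
    rintro i g ⟨x, p⟩ ⟨y, q⟩
    refine UniversalCover.mk_eq_mk.2 ?_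
    change ((Path.Homotopic.prod (p.trans g.toPath) (q.trans g.toPath)).map d).trans (c i) =
      ((Path.Homotopic.prod p q).map d).trans (c i)
    -- The loop `(g, g)` runs in the diagonal, where `d` is null-homotopic.
    have h1 : (Path.Homotopic.prod g.toPath g.toPath).map d = .refl _ := by
      refine Eq.trans ?_ (D.map_loop_eq_refl g.toPath)
      obtain ⟨r, hr⟩ := Path.Homotopic.Quotient.mk_surjective g.toPath
      rw [← hr]
      rfl
    rw [← Path.Homotopic.comp_prod_eq_prod_comp, SheetCover.map_trans, h1,
      Path.Homotopic.Quotient.trans_refl]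
  have hbij : ∀ i (η : UniversalCover x₀) (u : X) (v : UniversalCover (y₀ i)), v.1 = d (u, η.1) →
      ∃! ζ : UniversalCover x₀, ζ.1 = u ∧ Φ i ζ η = v := by
    rintro i ⟨b, η⟩ u ⟨_, v⟩ rfl
    obtain ⟨F⟩ := R b
    obtain ⟨hi, hj⟩ := F.bijective_map u x₀
    -- Moving the first coordinate before the second isolates the contribution of `η` as a fixed
    -- right factor `r`. The remaining dependence on `q` is bijective by `R b`.
    let r : Path.Homotopic.Quotient (d (x₀, b)) (y₀ i) :=
      (η.map (d.comp ((ContinuousMap.const X x₀).prodMk (ContinuousMap.id X)))).trans (c i)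
    have hr : ∀ q : Path.Homotopic.Quotient u x₀,
        ((Path.Homotopic.prod q η).map d).trans (c i) = (q.map (d.comp
          ((ContinuousMap.id X).prodMk (ContinuousMap.const X b)))).trans r := fun q =>
      (congrArg (·.trans (c i)) (Path.Homotopic.Quotient.map_prod d q η)).trans
        (Path.Homotopic.Quotient.trans_assoc _ _ _)
    obtain ⟨q, hq⟩ := hj (v.trans r.symm)
    refine ⟨⟨u, q⟩, ⟨rfl, UniversalCover.mk_eq_mk.2 ((hr q).trans ?_)⟩, ?_⟩
    · exact (congrArg (·.trans r) hq).trans (Path.Homotopic.Quotient.trans_symm_trans v r)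
    · rintro ⟨_, q'⟩ ⟨rfl, h⟩
      refine UniversalCover.mk_eq_mk.2 (hi (hq.trans ?_).symm)
      refine Path.Homotopic.Quotient.trans_right_cancel r
        ((Path.Homotopic.Quotient.trans_symm_trans v r).trans
          ((UniversalCover.mk_eq_mk.1 h).symm.trans (hr q')))
  let G₀ : (Fin (k + 1) → UniversalCover x₀) → UniversalCover y₀ := fun ζ =>
    UniversalCover.pi fun i => Φ i (ζ i.succ) (ζ 0)
  have hG₀ : Continuous G₀ := by
    refine (UniversalCover.continuous_pi fun _ => hX).comp (continuous_pi fun i => ?_)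
    have h : Continuous fun ζ : Fin (k + 1) → UniversalCover x₀ => (ζ i.succ, ζ 0) := by fun_prop
    exact (UniversalCover.continuous_map _ _).comp ((UniversalCover.continuous_prod hX hX).comp h)
  let G : DiagonalCover (k + 1) x₀ → UniversalCover y₀ := Quotient.lift G₀ <| by
    rintro z w ⟨g, rfl⟩
    exact congrArg UniversalCover.pi (funext fun i => hΦ i g (w i.succ) (w 0))
  have hG : Continuous G :=
    (DiagonalCover.isOpenQuotientMap_mk hX).isQuotientMap.continuous_iff.2 hG₀
  have hGmk : ∀ ζ i, UniversalCover.coord i (G (DiagonalCover.mk ζ)) = Φ i (ζ i.succ) (ζ 0) :=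
    fun ζ i => UniversalCover.coord_pi _ i
  refine dsecat_le_of_pullback (f := fun x i => d (x i.succ, x 0)) hl'.continuous
    hl'.isLocallyInjective hl.continuous hl.isOpenMap (by fun_prop) hG (fun w => ?_)
    fun a z hz => ?_
  · obtain ⟨w, rfl⟩ := DiagonalCover.mk_surjective w
    rfl
  -- Any lift of `a 0` fixes a representative of the orbit; the other coordinates are then solved
  -- for one at a time.
  · let η : UniversalCover x₀ := ⟨a 0, .mk (PathConnectedSpace.somePath _ _)⟩
    have hz' : ∀ i, (UniversalCover.coord i z).1 = d (a i.succ, η.1) := fun i => congrFun hz i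
    choose ζ hζ hζ' using fun i => hbij i η (a i.succ) (UniversalCover.coord i z) (hz' i)
    refine ⟨DiagonalCover.mk (Fin.cons η ζ : Fin (k + 1) → UniversalCover x₀),
      ⟨funext (Fin.cases rfl fun i => (hζ i).1),
        UniversalCover.ext_coord fun i => (hGmk _ i).trans (hζ i).2⟩, ?_⟩
    rintro w ⟨hw, hwz⟩
    obtain ⟨ξ, rfl⟩ := DiagonalCover.exists_eq_mk_cons w η (congrFun hw 0)
    refine congrArg (fun ζ => DiagonalCover.mk (Fin.cons η ζ : Fin (k + 1) → UniversalCover x₀))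
      (funext fun i => hζ' i (ξ i) ⟨congrFun hw i.succ, ?_⟩)
    exact (hGmk (Fin.cons η ξ : Fin (k + 1) → UniversalCover x₀) i).symm.trans
      (congrArg (UniversalCover.coord i) hwz)

end Comparison

/-! ### The theorem for H-spaces -/

/-- Right multiplication by a point of a path-connected H-space is homotopic to the identity. -/
theorem HSpace.nonempty_homotopy_hmul_const {X : Type*} [TopologicalSpace X] [HSpace X]
    [PathConnectedSpace X] (b : X) :
    Nonempty ((HSpace.hmul.comp ((ContinuousMap.id X).prodMk (ContinuousMap.const X b))).Homotopy
      (ContinuousMap.id X)) := by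
  let γ : Path b (HSpace.e : X) := PathConnectedSpace.somePath _ _
  let F : (HSpace.hmul.comp ((ContinuousMap.id X).prodMk (ContinuousMap.const X b))).Homotopy
      (HSpace.hmul.comp ((ContinuousMap.id X).prodMk (ContinuousMap.const X HSpace.e))) :=
    { toFun := fun q => HSpace.hmul (q.2, γ q.1)
      continuous_toFun := by fun_prop
      map_zero_left := fun x => by simp
      map_one_left := fun x => by simp }
  exact ⟨F.trans HSpace.hmulE.toHomotopy⟩

theorem mainTheorem11 (X : Type*) [TopologicalSpace X] [T2Space X] [ConnectedSpace X]
    [CWComplex (Set.univ : Set X)] [HSpace X] (m : ℕ) (hm : 2 ≤ m)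
    (x₀ : X) (y₀ : Fin (m - 1) → X) :
    dTCDiag m X x₀ = dcatOne (Fin (m - 1) → X) y₀ := by
  obtain ⟨k, rfl⟩ : ∃ k, m = k + 1 := ⟨m - 1, by omega⟩
  have hX : LocallyContractsInside X := CWComplex.locallyContractsInside
  have : CompletelyRegularSpace X := CWComplex.completelyRegularSpace
  have : LocallyPathConnectedSpace X := CWComplex.locallyPathConnectedSpace
  have : PathConnectedSpace X := PathConnectedSpace.of_locallyPathConnectedSpace
  obtain ⟨f, hf⟩ := HSpace.exists_right_inverse (X := X)
  let inv : C(X, X) := ⟨fun x => (f x).1, by fun_prop⟩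
  -- The homotopy right inverse contracts `d` on the diagonal, and `d (·, b)` is right
  -- multiplication by `inv b`.
  let d : C(X × X, X) := ⟨fun q => HSpace.hmul (q.1, inv q.2), by fun_prop⟩
  refine le_antisymm (dTCDiag_le_dcatOne hX k x₀ y₀ d HSpace.e
    { toFun := fun q => (f q.2).2 q.1
      continuous_toFun := Continuous.eval (by fun_prop) (by fun_prop)
      map_zero_left := fun x => (hf x).1
      map_one_left := fun x => (hf x).2 } fun b => ?_) (dcatOne_le_dTCDiag hX k x₀ y₀)
  exact HSpace.nonempty_homotopy_hmul_const (inv b)
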